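/- Let $d\ge 1$ and let $T=T(z)\in\mathbb{C}[[z]]$ be the generating function of $2d$-ary trees counted by their number of internal nodes, so $T=1+zT^{2d}$. Put $\zeta=z^{1/(2d-1)}$ and work in the field $\mathbb{C}((\zeta))$ of Puiseux series in $z$, with its $\zeta$-adic topology and order function $\operatorname{ord}_\zeta$. Put $Z=zT^{2d-1}$ and $B_{2d}=\{-(2d-1),-(2d-3),\dots,2d-1\}$. The characteristic equation $$1=zT^{2d-1}\sum_{\ell=1}^{d}\bigl(X^{2\ell-1}+X^{-2\ell+1}\bigr)$$ has exactly $2d-1$ small solutions $X_1,\dots,X_{2d-1}$, that is, solutions in $\mathbb{C}((\zeta))$ of positive order. For $m\in\mathbb{Z}$ and $\mathbf n\in\mathbb{N}_0^{2d-1}$ write $\mathbf X^{m\mathbf n}=\prod_{\ell} X_\ell^{m n_\ell}$, and let $\mathbf e_\ell$ be the $\ell$-th unit vector. For all values $\alpha_{\mathbf e_1},\dots,\alpha_{\mathbf e_{2d-1}}\in\mathbb{C}((\zeta))$ of the $2d-1$ free parameters there is exactly one family $\alpha_{\mathbf n}\in\mathbb{C}((\zeta))$, $\mathbf n\in\mathbb{N}_0^{2d-1}$,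 such that $\alpha_{\mathbf 0}=0$, $$\alpha_{n\mathbf e_\ell}=\frac{\alpha_{\mathbf e_\ell}^{n}\,X_\ell^{2(n-1)}\bigl(1-X_\ell^{n(2d-1)}\bigr)}{(1-X_\ell^{2d-1})(1-X_\ell^2)^{n-1}(1-X_\ell^{2d+1})^{n-1}}\qquad(n\ge1,\ 1\le\ell\le 2d-1),$$ and, for every $\mathbf n$ that is not a multiple of a unit vector, $$\alpha_{\mathbf n}\Bigl(-\frac1{Z}+\sum_{\ell=1}^{d}\bigl(\mathbf X^{(2\ell-1)\mathbf n}+\mathbf X^{(-2\ell+1)\mathbf n}\bigr)\Bigr)=\sum_{\ell=2}^{2d}(-1)^{\ell}\sum_{\mathbf g_1+\dots+\mathbf g_\ell=\mathbf n}\ \prod_{k=1}^{\ell}\alpha_{\mathbf g_k}\sum_{\substack{\{b_1<\dots<b_\ell\}\subseteq B_{2d}}}\ \prod_{k=1}^{\ell}\mathbf X^{b_k\mathbf g_k},\qquad(\ast)$$ where the $\mathbf g_k$ run over $\mathbb{N}_0^{2d-1}\setminus\{\mathbf 0\}$. This family satisfies $(\ast)$ for all $\mathbf n\notin\{\mathbf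 0,\mathbf e_1,\dots,\mathbf e_{2d-1}\}$. Moreover, it gives a $(2d-1)$-parameter formal solution $T_j=T(1-\rho_j)$, $\rho_j=\sum_{\mathbf n}\alpha_{\mathbf n}\mathbf X^{j\mathbf n}$, of the $2d$-ary recurrence $$T_j=1+z\prod_{\ell=1}^{d}T_{j+2\ell-1}\,T_{j-2\ell+1},$$ in both of the following senses. (a) With formal variables $\mathbf w=(w_1,\dots,w_{2d-1})$ and $\rho_j(\mathbf w)=\sum_{\mathbf n}\alpha_{\mathbf n}\mathbf X^{j\mathbf n}\mathbf w^{\mathbf n}$, the power series $T_j(\mathbf w)=T(1-\rho_j(\mathbf w))\in\mathbb{C}((\zeta))[[\mathbf w]]$ satisfy the recurrence for all $j\in\mathbb{Z}$. (b) The series $\rho_j=\sum_{\mathbf n}\alpha_{\mathbf n}\mathbf X^{j\mathbf n}$ is summable in $\mathbb{C}((\zeta))$ for every $j\in\mathbb{Z}$ with $\operatorname{ord}_\zeta(\alpha_{\mathbf e_\ell})+j+2>0$ for all $\ell$, and $T_j=T(1-\rho_j)\in\mathbb{C}((\zeta))$ satisfies the recurrence for every $j\in\mathbb{Z}$ with $\operatorname{ord}_\zeta(\alpha_{\mathbf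 e_\ell})+j-(2d-1)+2>0$ for all $\ell$ (so that all the series $\rho_{j\pm(2\ell-1)}$, $\rho_j$ that occur are summable). -/

import Mathlib

namespace EmbeddedTrees

noncomputable section

/-- Plane `k`-ary trees: a leaf (external node), or an internal node with `k` ordered subtrees. -/
inductive DaryTree (k : ℕ) : Type
  | leaf : DaryTree k
  | node : (Fin k → DaryTree k) → DaryTree k

/-- The size of a `k`-ary tree is its number of internal nodes. -/
def DaryTree.size {k : ℕ} : DaryTree k → ℕ
  | .leaf => 0
  | .node c => 1 + ∑ i, (c i).size

/-- The generating function `T(z) = ∑ₙ Tₙ zⁿ` of `k`-ary trees by size. -/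
def treeGF (k : ℕ) : PowerSeries ℂ :=
  PowerSeries.mk fun n => (Nat.card {t : DaryTree k // t.size = n} : ℂ)

/-- The field `ℂ((ζ))` of formal Laurent series. It is used with `z = ζ ^ (2d - 1)`, so that it is
the field of Puiseux series in `z` whose exponents are multiples of `1 / (2d - 1)`. -/
abbrev K : Type := LaurentSeries ℂ

/-- The variable `z = ζ ^ (2d - 1)`. -/
def zVar (d : ℕ) : K := ((PowerSeries.X ^ (2 * d - 1) : PowerSeries ℂ) : LaurentSeries ℂ)

/-- The generating function `T = T(z)` of `2d`-ary trees at `z = ζ ^ (2d - 1)`. -/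
def treeT (d : ℕ) : K :=
  ((PowerSeries.subst (PowerSeries.X ^ (2 * d - 1) : PowerSeries ℂ) (treeGF (2 * d)) :
    PowerSeries ℂ) : LaurentSeries ℂ)

/-- `Z = z T ^ (2d - 1)`. -/
def bigZ (d : ℕ) : K := zVar d * treeT d ^ (2 * d - 1)

/-- A small root of the characteristic equation
`1 = z T ^ (2d - 1) ∑_{ℓ = 1}^{d} (x ^ (2ℓ - 1) + x ^ (-2ℓ + 1))`:
a solution of positive order in `ζ` (so that it tends to `0` with `z`). -/
def IsSmallRoot (d : ℕ) (x : K) : Prop :=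
  0 < x.orderTop ∧
    1 = bigZ d * ∑ l ∈ Finset.Icc 1 d, (x ^ (2 * (l : ℤ) - 1) + x ^ (-2 * (l : ℤ) + 1))

/-- Multi-indices `𝐧 = (n₁, …, n_{2d-1})`. -/
abbrev MultiIndex (d : ℕ) : Type := Fin (2 * d - 1) →₀ ℕ

/-- `𝐗 ^ (m 𝐧) = ∏ₗ Xₗ ^ (m nₗ)` for an integer `m`. -/
def monom {d : ℕ} (X : Fin (2 * d - 1) → K) (m : ℤ) (n : MultiIndex d) : K :=
  ∏ l, X l ^ (m * (n l : ℤ))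

/-- `B_{2d} = {-(2d - 1), -(2d - 3), …, 2d - 1}`. -/
def stepSet (d : ℕ) : Finset ℤ :=
  (Finset.range (2 * d)).image fun i : ℕ => 2 * (i : ℤ) - (2 * (d : ℤ) - 1)

/-- The factor `-1 / (z T ^ (2d - 1)) + ∑_{ℓ = 1}^{d} (𝐗 ^ ((2ℓ - 1) 𝐧) + 𝐗 ^ ((-2ℓ + 1) 𝐧))`. -/
def recFactor {d : ℕ} (X : Fin (2 * d - 1) → K) (n : MultiIndex d) : K :=
  -1 / bigZ d +
    ∑ l ∈ Finset.Icc 1 d, (monom X (2 * (l : ℤ) - 1) n + monom X (-2 * (l : ℤ) + 1) n)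

open Classical in
/-- The right-hand side of the recurrence,
`∑_{k = 2}^{2d} (-1) ^ k ∑_{b ⊆ B_{2d}, |b| = k} ∑_𝐠 ∏_{i ∈ b} α_{𝐠ᵢ} 𝐗 ^ (i 𝐠ᵢ)`.
The `k`-tuple `𝐠` of nonzero multi-indices with sum `𝐧` is indexed by the elements of `b`
(in increasing order) instead of by `1, …, k`; `Finset.piAntidiag b n` is the set of the families
`(gᵢ)_{i ∈ b}` with sum `n`, extended by `0` outside `b`. -/
def recRHS {d : ℕ} (X : Fin (2 * d - 1) → K) (α : MultiIndex d → K) (n : MultiIndex d) : K :=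
  ∑ k ∈ Finset.Icc 2 (2 * d), (-1) ^ k *
    ∑ b ∈ (stepSet d).powersetCard k,
      ∑ g ∈ (Finset.piAntidiag b n).filter (fun g => ∀ i ∈ b, g i ≠ 0),
        ∏ i ∈ b, α (g i) * monom X i (g i)

/-- The recurrence relation for the coefficients, at the multi-index `n`. -/
def RecurrenceAt {d : ℕ} (X : Fin (2 * d - 1) → K) (α : MultiIndex d → K)
    (n : MultiIndex d) : Prop :=
  α n * recFactor X n = recRHS X α n

/-- `α` is the family of coefficients with free parameters `α_{𝐞ₗ} = aₗ`: zero at `𝟎`, given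
explicitly at `𝐧 = (m + 1) 𝐞ₗ`, and by the recurrence at all multi-indices in no one direction. -/
structure IsCoeffFamily {d : ℕ} (X a : Fin (2 * d - 1) → K) (α : MultiIndex d → K) : Prop where
  zero : α 0 = 0
  axis : ∀ (l : Fin (2 * d - 1)) (m : ℕ), α (Finsupp.single l (m + 1)) =
    a l ^ (m + 1) * X l ^ (2 * m) * (1 - X l ^ ((m + 1) * (2 * d - 1))) /
      ((1 - X l ^ (2 * d - 1)) * (1 - X l ^ 2) ^ m * (1 - X l ^ (2 * d + 1)) ^ m)
  recurrence : ∀ n : MultiIndex d, (∀ l m, n ≠ Finsupp.single l m) → RecurrenceAt X α n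

/-- `∑_𝐧 α_𝐧 𝐗 ^ (j 𝐧) 𝐰 ^ 𝐧` as a formal power series in the variables `w₁, …, w_{2d-1}`. -/
def formalRho {d : ℕ} (X : Fin (2 * d - 1) → K) (α : MultiIndex d → K) (j : ℤ) :
    MvPowerSeries (Fin (2 * d - 1)) K :=
  fun n => α n * monom X j n

/-- `T (1 - ρⱼ)` with the formal variables `𝐰`. -/
def formalT {d : ℕ} (X : Fin (2 * d - 1) → K) (α : MultiIndex d → K) (j : ℤ) :
    MvPowerSeries (Fin (2 * d - 1)) K :=
  MvPowerSeries.C (treeT d) * (1 - formalRho X α j)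

/-- `ρⱼ = ∑_𝐧 α_𝐧 𝐗 ^ (j 𝐧)`, summed in the `ζ`-adic topology of `ℂ((ζ))`. -/
def rho {d : ℕ} (X : Fin (2 * d - 1) → K) (α : MultiIndex d → K) (j : ℤ) : K :=
  ∑' n : MultiIndex d, α n * monom X j n

/-- `Tⱼ = T (1 - ρⱼ)`. -/
def seriesT {d : ℕ} (X : Fin (2 * d - 1) → K) (α : MultiIndex d → K) (j : ℤ) : K :=
  treeT d * (1 - rho X α j)

end

end EmbeddedTrees

/-!
Three ingredients carry the proof.

*Small roots.* With `N = 2d - 1` and `x = ζ / y` the characteristic equation becomes a monic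
polynomial equation for `y` over `ℂ[[ζ]]` (`recipPoly`) whose reduction modulo `ζ` is
`y ^ (2N) - y ^ N`. Its nonzero roots are simple, so by Hensel's lemma they lift uniquely, one for
each `N`-th root of unity (`ncard_smallRoots`). In particular every small root has order `1`.

*The recurrence as an identity of power series.* Since `T = 1 + Z T`, the `2d`-ary recurrence for
`T (1 - ρⱼ)` is equivalent to `1 - ρⱼ = 1 - Z + Z ∏_{b ∈ B} (1 - ρⱼ₊ᵦ)`, and comparing coefficients
of `𝐰 ^ n` gives exactly the recurrence for `α_n` (`coeff_eq_iff_recurrenceAt`). For `|n| ≥ 2` the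
factor of `α_n` has order `-N |n|` and is therefore nonzero (`orderTop_recFactor`), so the
recurrence determines `α_n` off the axes. On an axis the explicit coefficients are a difference of
two geometric progressions, and with `v = s xʲ w` for a suitable constant `s` they sum to
`1 - ρⱼ = (1 - v x⁻²) (1 - v x ^ (N + 2)) / ((1 - v) (1 - v x ^ N))` (`axisSeries_mul`).
The product over `b ∈ B` of these quotients telescopes (`prod_axisSeries_mul`), and what remains is
an identity of polynomials of degree two in `v` whose linear coefficient is the characteristic
equation (`axisSeries_eq`). Hence the recurrence holds at every multi-index.

*Convergence.* If all `a_l` have order at least `A`, then `α_n` has order at least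
`A |n| + 2 (|n| - 1)` (`IsCoeffFamily.le_orderTop`), so the terms of `ρⱼ` tend to `0` as soon as
`A + j + 2 > 0`. In the complete nonarchimedean field `ℂ((ζ))` this implies summability, and
evaluation at `𝐰 = (1, …, 1)` is compatible with products (`hasSum_coeff_mul`), which turns the
formal identity into the identity for the sums.
-/

namespace EmbeddedTrees

noncomputable section

/-! ### The generating function of `k`-ary trees -/

theorem DaryTree.subsingleton_size_zero (k : ℕ) :
    Subsingleton {t : DaryTree k // t.size = 0} := by
  refine ⟨?_⟩
  rintro ⟨t, ht⟩ ⟨s, hs⟩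
  cases t <;> cases s <;> simp only [DaryTree.size] at ht hs <;> first | rfl | omega

/-- The sizes of the trees in a family determine the first component of the pair. -/
theorem DaryTree.sigma_size_ext {k n : ℕ} (f : Fin k → ℕ)
    (hf : f ∈ Finset.piAntidiag Finset.univ n) (g : ∀ i, {t : DaryTree k // t.size = f i})
    (hf' : (fun i => (g i).1.size) ∈ Finset.piAntidiag Finset.univ n := by
      simpa only [(g _).2] using hf) :
    (⟨⟨fun i => (g i).1.size, hf'⟩, fun i => ⟨(g i).1, rfl⟩⟩ :
      Σ f : {f : Fin k → ℕ // f ∈ Finset.piAntidiag Finset.univ n},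
        ∀ i, {t : DaryTree k // t.size = f.1 i}) = ⟨⟨f, hf⟩, g⟩ := by
  have h : (fun i => (g i).1.size) = f := funext fun i => (g i).2
  refine Sigma.ext (Subtype.ext h) (Function.hfunext rfl fun i i' hi => ?_)
  obtain rfl := eq_of_heq hi
  exact (Subtype.heq_iff_coe_eq fun t => by simp only [(g i).2]).2 rfl

/-- A tree of size `n + 1` is the sequence of its subtrees, whose sizes add up to `n`. -/
def DaryTree.sizeSuccEquiv (k n : ℕ) :
    {t : DaryTree k // t.size = n + 1} ≃
      Σ f : {f : Fin k → ℕ // f ∈ Finset.piAntidiag Finset.univ n},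
        ∀ i, {t : DaryTree k // t.size = f.1 i} where
  toFun
    | ⟨.leaf, h⟩ => absurd h (by simp [DaryTree.size])
    | ⟨.node c, h⟩ =>
      ⟨⟨fun i => (c i).size, by simp [DaryTree.size] at h ⊢; omega⟩, fun i => ⟨c i, rfl⟩⟩
  invFun x := ⟨.node fun i => (x.2 i).1, by
    have h := x.1.2
    have h' : ∀ i, (x.2 i).1.size = x.1.1 i := fun i => (x.2 i).2
    simp only [Finset.mem_piAntidiag] at h
    simp only [DaryTree.size, h', h.1]
    omega⟩
  left_inv := by
    rintro ⟨t, h⟩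
    cases t with
    | leaf => simp [DaryTree.size] at h
    | node c => rfl
  right_inv := by
    rintro ⟨⟨f, hf⟩, g⟩
    exact DaryTree.sigma_size_ext f hf g

/-- Finiteness makes the cardinalities in `treeGF` genuine counts: `Nat.card` of an infinite type
is `0`. -/
theorem DaryTree.finite_size (k n : ℕ) : Finite {t : DaryTree k // t.size = n} := by
  induction n using Nat.strong_induction_on with
  | _ n ih =>
    cases n with
    | zero =>
      exact @Finite.of_subsingleton _ (DaryTree.subsingleton_size_zero k)
    | succ n =>
      have (f : {f : Fin k → ℕ // f ∈ Finset.piAntidiag Finset.univ n}) (i : Fin k) :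
          Finite {t : DaryTree k // t.size = f.1 i} := by
        refine ih _ (Nat.lt_succ_of_le ?_)
        have h := f.2
        simp only [Finset.mem_piAntidiag] at h
        exact (Finset.single_le_sum (f := f.1) (fun _ _ => Nat.zero_le _)
          (Finset.mem_univ i)).trans_eq h.1
      exact Finite.of_equiv _ (DaryTree.sizeSuccEquiv k n).symm

theorem DaryTree.card_size_succ (k n : ℕ) :
    Nat.card {t : DaryTree k // t.size = n + 1} =
      ∑ f ∈ Finset.piAntidiag (Finset.univ : Finset (Fin k)) n,
        ∏ i, Nat.card {t : DaryTree k // t.size = f i} := by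
  have (f : {f : Fin k → ℕ // f ∈ Finset.piAntidiag Finset.univ n}) (i : Fin k) :
      Finite {t : DaryTree k // t.size = f.1 i} := DaryTree.finite_size k _
  rw [Nat.card_congr (DaryTree.sizeSuccEquiv k n), Nat.card_sigma]
  simp only [Nat.card_pi]
  exact Finset.sum_coe_sort _ fun f : Fin k → ℕ =>
    ∏ i, Nat.card {t : DaryTree k // t.size = f i}

theorem DaryTree.card_size_zero (k : ℕ) : Nat.card {t : DaryTree k // t.size = 0} = 1 := by
  rw [Nat.card_eq_one_iff_unique]
  exact ⟨DaryTree.subsingleton_size_zero k, ⟨⟨.leaf, rfl⟩⟩⟩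

theorem sum_finsuppAntidiag_eq_sum_piAntidiag {ι μ M : Type*} [DecidableEq ι] [AddCommMonoid μ]
    [Finset.HasAntidiagonal μ] [DecidableEq μ] [AddCommMonoid M] (s : Finset ι) (n : μ)
    (F : (ι → μ) → M) :
    ∑ g ∈ Finset.finsuppAntidiag s n, F g = ∑ g ∈ Finset.piAntidiag s n, F g := by
  refine Finset.sum_bij (fun g _ => ⇑g) ?_ ?_ ?_ fun _ _ => rfl
  · intro g hg
    rw [Finset.mem_finsuppAntidiag] at hg
    rw [Finset.mem_piAntidiag]
    exact ⟨hg.1, fun i hi => hg.2 (Finsupp.mem_support_iff.2 hi)⟩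
  · exact fun _ _ _ _ h => DFunLike.coe_injective h
  · intro g hg
    rw [Finset.mem_piAntidiag] at hg
    refine ⟨Finsupp.onFinset s g hg.2, ?_, rfl⟩
    rw [Finset.mem_finsuppAntidiag]
    exact ⟨hg.1, Finsupp.support_onFinset_subset⟩

theorem treeGF_eq (k : ℕ) : treeGF k = 1 + PowerSeries.X * treeGF k ^ k := by
  ext n
  cases n with
  | zero => simp [treeGF, DaryTree.card_size_zero]
  | succ n =>
    rw [map_add, PowerSeries.coeff_succ_X_mul]
    have h : treeGF k ^ k = ∏ _i : Fin k, treeGF k := by simp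
    rw [h, PowerSeries.coeff_prod, sum_finsuppAntidiag_eq_sum_piAntidiag _ _
      fun g : Fin k → ℕ => ∏ i, PowerSeries.coeff (g i) (treeGF k)]
    simp [treeGF, DaryTree.card_size_succ, PowerSeries.coeff_one]

/-- The power series in `ζ` whose image in `ℂ((ζ))` is `treeT d`. -/
def treeSeries (d : ℕ) : PowerSeries ℂ :=
  PowerSeries.subst (PowerSeries.X ^ (2 * d - 1) : PowerSeries ℂ) (treeGF (2 * d))

theorem treeSeries_eq {d : ℕ} (hd : 1 ≤ d) :
    treeSeries d = 1 + PowerSeries.X ^ (2 * d - 1) * treeSeries d ^ (2 * d) := by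
  have hs : PowerSeries.HasSubst (PowerSeries.X ^ (2 * d - 1) : PowerSeries ℂ) :=
    PowerSeries.HasSubst.X_pow (by omega)
  have h := congrArg (PowerSeries.substAlgHom (R := ℂ) hs) (treeGF_eq (2 * d))
  rw [map_add, map_one, map_mul, map_pow, PowerSeries.substAlgHom_X,
    PowerSeries.coe_substAlgHom] at h
  exact h

theorem constantCoeff_treeSeries {d : ℕ} (hd : 1 ≤ d) :
    PowerSeries.constantCoeff (treeSeries d) = 1 := by
  rw [treeSeries_eq hd]
  simp [show 2 * d - 1 ≠ 0 by omega]

theorem treeT_eq {d : ℕ} (hd : 1 ≤ d) : treeT d = 1 + zVar d * treeT d ^ (2 * d) := by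
  have h := congrArg (HahnSeries.ofPowerSeries ℤ ℂ) (treeSeries_eq hd)
  rw [map_add, map_one, map_mul, map_pow (HahnSeries.ofPowerSeries ℤ ℂ) (treeSeries d)] at h
  exact h

/-- The form `1 / T = 1 - Z` of the functional equation, with denominators cleared. -/
theorem treeT_eq_bigZ {d : ℕ} (hd : 1 ≤ d) : treeT d = 1 + bigZ d * treeT d := by
  conv_lhs => rw [treeT_eq hd]
  rw [bigZ, mul_assoc, ← pow_succ, show 2 * d - 1 + 1 = 2 * d by omega]

theorem orderTop_coe_nonneg (f : PowerSeries ℂ) : 0 ≤ (f : K).orderTop := by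
  rw [HahnSeries.le_orderTop_iff_forall]
  intro j hj
  rw [PowerSeries.coeff_coe, if_pos (by exact_mod_cast hj)]

theorem orderTop_coe_of_constantCoeff_ne_zero {f : PowerSeries ℂ}
    (hf : PowerSeries.constantCoeff f ≠ 0) : (f : K).orderTop = 0 := by
  refine le_antisymm ?_ (orderTop_coe_nonneg f)
  refine HahnSeries.orderTop_le_of_coeff_ne_zero (g := (0 : ℤ)) ?_
  have h := LaurentSeries.coeff_coe_powerSeries f 0
  rw [Nat.cast_zero] at h
  rw [h]
  simpa using hf

theorem map_pow_treeT (d n : ℕ) : ((treeSeries d ^ n : PowerSeries ℂ) : K) = treeT d ^ n :=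
  map_pow (HahnSeries.ofPowerSeries ℤ ℂ) (treeSeries d) n

theorem orderTop_treeT {d : ℕ} (hd : 1 ≤ d) : (treeT d).orderTop = 0 :=
  orderTop_coe_of_constantCoeff_ne_zero ((constantCoeff_treeSeries hd).trans_ne one_ne_zero)

theorem treeT_ne_zero {d : ℕ} (hd : 1 ≤ d) : treeT d ≠ 0 := by
  rw [← HahnSeries.orderTop_ne_top, orderTop_treeT hd]
  exact WithTop.zero_ne_top

theorem orderTop_bigZ {d : ℕ} (hd : 1 ≤ d) : (bigZ d).orderTop = ((2 * d - 1 : ℕ) : ℤ) := by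
  rw [bigZ, HahnSeries.orderTop_mul, zVar, HahnSeries.ofPowerSeries_X_pow,
    HahnSeries.orderTop_single one_ne_zero, ← map_pow_treeT,
    orderTop_coe_of_constantCoeff_ne_zero (by simp [constantCoeff_treeSeries hd]), add_zero]
theorem bigZ_ne_zero {d : ℕ} (hd : 1 ≤ d) : bigZ d ≠ 0 := by
  rw [← HahnSeries.orderTop_ne_top, orderTop_bigZ hd]
  exact WithTop.coe_ne_top

/-! ### Summation in `ℂ((ζ))` -/

instance : NonarchimedeanRing K :=
  (Valued.v : Valuation K _).subgroups_basis.nonarchimedean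

/-- In a complete nonarchimedean group a family that tends to `0` is summable. -/
theorem summable_of_orderTop_tendsto {ι : Type*} {f : ι → K}
    (hf : ∀ D : ℤ, ∀ᶠ i in Filter.cofinite, (D : WithTop ℤ) ≤ (f i).orderTop) : Summable f := by
  refine NonarchimedeanAddGroup.summable_of_tendsto_cofinite_zero ?_
  intro s hs
  obtain ⟨γ, hγ⟩ := Valued.mem_nhds_zero.1 hs
  have h0 : MonoidWithZeroHom.ValueGroup₀.embedding γ.1 ≠ 0 := by simp
  rw [Filter.mem_map]
  filter_upwards [hf (1 - WithZero.log (MonoidWithZeroHom.ValueGroup₀.embedding γ.1))] with i hi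
  refine hγ ?_
  rw [Set.mem_ofPred_eq, Valuation.restrict_lt_iff_lt_embedding]
  refine lt_of_le_of_lt ((LaurentSeries.valuation_le_iff_coeff_lt_eq_zero ℂ).2
    fun n hn => HahnSeries.coeff_eq_zero_of_lt_orderTop
      (lt_of_lt_of_le (WithTop.coe_lt_coe.2 hn) hi)) ?_
  rw [← WithZero.exp_log h0, WithZero.exp_lt_exp, WithZero.log_exp]
  omega

/-- The values at `𝐰 = (1, …, 1)` of two formal power series multiply. -/
theorem hasSum_coeff_mul {σ : Type*} {f g : MvPowerSeries σ K} {s t : K}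
    (hf : HasSum (fun n => MvPowerSeries.coeff n f) s)
    (hg : HasSum (fun n => MvPowerSeries.coeff n g) t) :
    HasSum (fun n => MvPowerSeries.coeff n (f * g)) (s * t) := by
  classical
  have h := hf.mul_of_nonarchimedean hg
  have h1 := Summable.tsum_mul_tsum_eq_tsum_sum_antidiagonal hf.summable hg.summable h.summable
  have h2 := summable_sum_mul_antidiagonal_of_summable_mul h.summable
  rw [hf.tsum_eq, hg.tsum_eq] at h1
  simp only [MvPowerSeries.coeff_mul]
  rw [h1]
  exact h2.hasSum

theorem hasSum_coeff_C {σ : Type*} (c : K) :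
    HasSum (fun n => MvPowerSeries.coeff n (MvPowerSeries.C (σ := σ) c)) c := by
  classical
  have h := hasSum_ite_eq (0 : σ →₀ ℕ) c
  simpa only [MvPowerSeries.coeff_C] using h

theorem hasSum_coeff_prod {σ ι : Type*} (s : Finset ι) {f : ι → MvPowerSeries σ K} {t : ι → K}
    (h : ∀ i ∈ s, HasSum (fun n => MvPowerSeries.coeff n (f i)) (t i)) :
    HasSum (fun n => MvPowerSeries.coeff n (∏ i ∈ s, f i)) (∏ i ∈ s, t i) := by
  classical
  induction s using Finset.induction_on with
  | empty => simpa using hasSum_coeff_C (σ := σ) 1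
  | insert a s ha ih =>
    rw [Finset.prod_insert ha, Finset.prod_insert ha]
    exact hasSum_coeff_mul (h a (Finset.mem_insert_self a s))
      (ih fun i hi => h i (Finset.mem_insert_of_mem hi))

/-! ### Sums and products over the step set -/

@[to_additive]
theorem prod_stepSet {M : Type*} [CommMonoid M] (d : ℕ) (f : ℤ → M) :
    ∏ b ∈ stepSet d, f b =
      ∏ l ∈ Finset.Icc 1 d, (f (2 * (l : ℤ) - 1) * f (-2 * (l : ℤ) + 1)) := by
  have h : stepSet d = (Finset.Icc 1 d).image (fun l : ℕ => 2 * (l : ℤ) - 1) ∪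
      (Finset.Icc 1 d).image (fun l : ℕ => -2 * (l : ℤ) + 1) := by
    ext b
    simp only [stepSet, Finset.mem_image, Finset.mem_range, Finset.mem_union, Finset.mem_Icc]
    constructor
    · rintro ⟨i, hi, rfl⟩
      rcases lt_or_ge i d with h | h
      · exact Or.inr ⟨d - i, by omega, by omega⟩
      · exact Or.inl ⟨i + 1 - d, by omega, by omega⟩
    · rintro (⟨l, hl, rfl⟩ | ⟨l, hl, rfl⟩)
      · exact ⟨l + d - 1, by omega, by omega⟩
      · exact ⟨d - l, by omega, by omega⟩
  rw [h, Finset.prod_union, Finset.prod_image, Finset.prod_image, Finset.prod_mul_distrib]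
  · intro a _ b _ h; simp only at h; omega
  · intro a _ b _ h; simp only at h; omega
  · rw [Finset.disjoint_left]
    simp only [Finset.mem_image, Finset.mem_Icc]
    rintro b ⟨l, hl, rfl⟩ ⟨m, hm, h⟩
    omega

@[to_additive]
theorem prod_stepSet_range {M : Type*} [CommMonoid M] (d : ℕ) (f : ℤ → M) :
    ∏ b ∈ stepSet d, f b = ∏ i ∈ Finset.range (2 * d), f (2 * (i : ℤ) - (2 * (d : ℤ) - 1)) := by
  rw [stepSet, Finset.prod_image]
  intro a _ b _ h
  simp only at h
  omega

theorem card_stepSet (d : ℕ) : (stepSet d).card = 2 * d := by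
  rw [stepSet, Finset.card_image_of_injective, Finset.card_range]
  intro a b h
  simp only at h
  omega

/-! ### Small roots of the characteristic equation -/

theorem sum_symm_eq {d : ℕ} (hd : 1 ≤ d) {x : K} (hx : x ≠ 0) :
    ∑ l ∈ Finset.Icc 1 d, (x ^ (2 * (l : ℤ) - 1) + x ^ (-2 * (l : ℤ) + 1)) =
      (∑ i ∈ Finset.range (2 * d), x ^ (2 * i)) / x ^ (2 * d - 1) := by
  rw [← sum_stepSet d fun b : ℤ => x ^ b, sum_stepSet_range, Finset.sum_div]
  refine Finset.sum_congr rfl fun i _ => ?_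
  rw [zpow_sub₀ hx, ← zpow_natCast, ← zpow_natCast x (2 * d - 1), Nat.cast_sub (by omega)]
  push_cast
  rfl

theorem IsSmallRoot.ne_zero {d : ℕ} {x : K} (hx : IsSmallRoot d x) : x ≠ 0 := by
  rintro rfl
  have h := hx.2
  rw [Finset.sum_eq_zero, mul_zero] at h
  · exact one_ne_zero h
  · intro l hl
    rw [Finset.mem_Icc] at hl
    rw [zero_zpow _ (by omega), zero_zpow _ (by omega), add_zero]

/-- The characteristic equation with denominators cleared. -/
theorem isSmallRoot_iff {d : ℕ} (hd : 1 ≤ d) {x : K} (hx : x ≠ 0) :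
    IsSmallRoot d x ↔ 0 < x.orderTop ∧
      x ^ (2 * d - 1) = bigZ d * ∑ i ∈ Finset.range (2 * d), x ^ (2 * i) := by
  rw [IsSmallRoot, sum_symm_eq hd hx, ← mul_div_assoc, eq_div_iff (pow_ne_zero _ hx), one_mul]

theorem orderTop_pow (x : K) (n : ℕ) : (x ^ n).orderTop = n • x.orderTop :=
  (HahnSeries.addVal ℤ ℂ).map_pow x n

theorem orderTop_one_add {x : K} (hx : 0 < x.orderTop) : (1 + x).orderTop = 0 := by
  have h := (HahnSeries.addVal ℤ ℂ).map_add_eq_of_lt_left (x := 1) (y := x)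
  simp only [HahnSeries.addVal_apply, HahnSeries.orderTop_one] at h
  exact h hx

theorem one_sub_ne_zero_of_orderTop_pos {x : K} (hx : 0 < x.orderTop) : 1 - x ≠ 0 := by
  intro h
  rw [← sub_eq_zero.1 h, HahnSeries.orderTop_one] at hx
  exact lt_irrefl _ hx

theorem orderTop_pow_pos {x : K} (hx : 0 < x.orderTop) {n : ℕ} (hn : n ≠ 0) :
    0 < (x ^ n).orderTop := by
  rw [orderTop_pow]
  exact nsmul_pos hx hn

/-- Both sides of `x ^ (2d - 1) = Z (1 + x ^ 2 + ⋯)` have the same order, and `Z` has order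
`2d - 1`. -/
theorem IsSmallRoot.orderTop_eq {d : ℕ} (hd : 1 ≤ d) {x : K} (hx : IsSmallRoot d x) :
    x.orderTop = ((1 : ℤ) : WithTop ℤ) := by
  have h := ((isSmallRoot_iff hd hx.ne_zero).1 hx).2
  have h1 : (∑ i ∈ Finset.range (2 * d), x ^ (2 * i)).orderTop = 0 := by
    rw [show 2 * d = (2 * d - 1) + 1 by omega, Finset.sum_range_succ', add_comm]
    refine orderTop_one_add ?_
    exact (HahnSeries.addVal ℤ ℂ).map_lt_sum WithTop.zero_ne_top
      fun i _ => orderTop_pow_pos hx.1 (by omega)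
  have h2 := congrArg HahnSeries.orderTop h
  rw [orderTop_pow, HahnSeries.orderTop_mul, h1, orderTop_bigZ hd, add_zero] at h2
  obtain ⟨m, hm⟩ := WithTop.ne_top_iff_exists.1 (HahnSeries.orderTop_ne_top.2 hx.ne_zero)
  rw [← hm] at h2 ⊢
  rw [← WithTop.coe_nsmul, WithTop.coe_inj, nsmul_eq_mul] at h2
  have h3 : ((2 * d - 1 : ℕ) : ℤ) ≠ 0 := by omega
  rw [mul_right_eq_self₀] at h2
  rcases h2 with h2 | h2
  · rw [h2]
  · exact absurd h2 h3

open Polynomial in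
/-- The polynomial over `ℂ[[ζ]]` whose roots `y` with nonzero constant coefficient correspond to the
small roots `ζ / y`. The characteristic equation is written in the reciprocal of `x / ζ` because
this makes the polynomial monic. -/
def recipPoly (d : ℕ) : Polynomial (PowerSeries ℂ) :=
  ∑ i ∈ Finset.range (2 * d), C (PowerSeries.X ^ (2 * i)) * X ^ (2 * (2 * d - 1 - i)) -
    C ((treeSeries d ^ (2 * d - 1))⁻¹) * X ^ (2 * d - 1)

open Polynomial in
theorem monic_recipPoly {d : ℕ} (hd : 1 ≤ d) : (recipPoly d).Monic := by
  have h : recipPoly d = X ^ (2 * (2 * d - 1)) +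
      (∑ i ∈ Finset.range (2 * d - 1),
          C (PowerSeries.X ^ (2 * (i + 1))) * X ^ (2 * (2 * d - 1 - (i + 1))) -
        C ((treeSeries d ^ (2 * d - 1))⁻¹) * X ^ (2 * d - 1)) := by
    rw [recipPoly]
    conv_lhs => rw [show 2 * d = (2 * d - 1) + 1 by omega, Finset.sum_range_succ']
    simp only [Nat.add_sub_cancel, mul_zero, pow_zero, map_one, one_mul, Nat.sub_zero]
    ring
  rw [h]
  refine monic_X_pow_add ?_
  rw [← mem_degreeLT]
  refine sub_mem (sum_mem fun i hi => ?_) ?_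
  · rw [Finset.mem_range] at hi
    rw [mem_degreeLT]
    exact (degree_C_mul_X_pow_le _ _).trans_lt (by exact_mod_cast (by omega))
  · rw [mem_degreeLT]
    exact (degree_C_mul_X_pow_le _ _).trans_lt (by exact_mod_cast (by omega))

open Polynomial in
theorem map_recipPoly {d : ℕ} (hd : 1 ≤ d) :
    (recipPoly d).map PowerSeries.constantCoeff =
      X ^ (2 * (2 * d - 1)) - X ^ (2 * d - 1) := by
  rw [recipPoly, Polynomial.map_sub, Polynomial.map_sum,
    Finset.sum_eq_single_of_mem 0 (Finset.mem_range.2 (by omega))]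
  · simp [PowerSeries.constantCoeff_inv, constantCoeff_treeSeries hd]
  · intro i _ hi
    simp [hi]

theorem constantCoeff_eval_recipPoly {d : ℕ} (hd : 1 ≤ d) (y : PowerSeries ℂ) :
    PowerSeries.constantCoeff ((recipPoly d).eval y) =
      PowerSeries.constantCoeff y ^ (2 * (2 * d - 1)) -
        PowerSeries.constantCoeff y ^ (2 * d - 1) := by
  rw [← Polynomial.eval_map_apply, map_recipPoly hd]
  simp

/-- The polynomial is separable modulo `ζ` away from `0`. -/
theorem isUnit_eval_derivative_recipPoly {d : ℕ} (hd : 1 ≤ d) {y : PowerSeries ℂ}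
    (hy : PowerSeries.constantCoeff y ^ (2 * d - 1) = 1) :
    IsUnit ((recipPoly d).derivative.eval y) := by
  rw [PowerSeries.isUnit_iff_constantCoeff, ← Polynomial.eval_map_apply,
    ← Polynomial.derivative_map, map_recipPoly hd]
  set c := PowerSeries.constantCoeff y
  have hc : c ≠ 0 := by
    intro h
    rw [h, zero_pow (by omega)] at hy
    exact zero_ne_one hy
  rw [isUnit_iff_ne_zero]
  simp only [Polynomial.derivative_sub, Polynomial.derivative_X_pow, Polynomial.eval_sub,
    Polynomial.eval_mul, Polynomial.eval_C, Polynomial.eval_pow, Polynomial.eval_X]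
  intro h
  have h1 : c ^ (2 * (2 * d - 1) - 1) * c = 1 := by
    rw [← pow_succ, show 2 * (2 * d - 1) - 1 + 1 = (2 * d - 1) * 2 by omega, pow_mul, hy, one_pow]
  have h2 : c ^ (2 * d - 1 - 1) * c = 1 := by
    rw [← pow_succ, show 2 * d - 1 - 1 + 1 = 2 * d - 1 by omega, hy]
  have h3 : ((2 * d - 1 : ℕ) : ℂ) = 0 := by
    have := congrArg (· * c) h
    simp only [sub_mul, mul_assoc, h1, h2, zero_mul] at this
    push_cast at this ⊢
    linear_combination this
  rw [Nat.cast_eq_zero] at h3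
  omega

theorem exists_recipPoly_root {d : ℕ} (hd : 1 ≤ d) {c : ℂ} (hc : c ^ (2 * d - 1) = 1) :
    ∃ y : PowerSeries ℂ, (recipPoly d).eval y = 0 ∧ PowerSeries.constantCoeff y = c := by
  obtain ⟨y, hy, hyc⟩ := HenselianRing.is_henselian
    (I := Ideal.span {(PowerSeries.X : PowerSeries ℂ)})
    (recipPoly d) (monic_recipPoly hd) (PowerSeries.C c)
    (by
      rw [Ideal.mem_span_singleton, PowerSeries.X_dvd_iff, constantCoeff_eval_recipPoly hd,
        PowerSeries.constantCoeff_C, mul_comm, pow_mul, hc]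
      ring)
    ((isUnit_eval_derivative_recipPoly hd (by simpa using hc)).map _)
  refine ⟨y, hy, ?_⟩
  rw [Ideal.mem_span_singleton, PowerSeries.X_dvd_iff, map_sub, PowerSeries.constantCoeff_C] at hyc
  exact sub_eq_zero.1 hyc

/-- The uniqueness part of Hensel's lemma, from the Taylor expansion of the polynomial at `y`. -/
theorem recipPoly_root_unique {d : ℕ} (hd : 1 ≤ d) {y y' : PowerSeries ℂ}
    (hy : (recipPoly d).eval y = 0) (hy' : (recipPoly d).eval y' = 0)
    (hc : PowerSeries.constantCoeff y ^ (2 * d - 1) = 1)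
    (h : PowerSeries.constantCoeff y = PowerSeries.constantCoeff y') : y = y' := by
  obtain ⟨k, hk⟩ := (recipPoly d).binomExpansion y (y' - y)
  rw [add_sub_cancel, hy, hy'] at hk
  have hu : IsUnit ((recipPoly d).derivative.eval y + k * (y' - y)) := by
    have := isUnit_eval_derivative_recipPoly hd hc
    rw [PowerSeries.isUnit_iff_constantCoeff] at this ⊢
    simpa [h] using this
  have h0 : ((recipPoly d).derivative.eval y + k * (y' - y)) * (y' - y) = 0 := by
    linear_combination -hk
  exact (sub_eq_zero.1 (hu.mul_right_eq_zero.1 h0)).symm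

/-- `ζ` as an element of `ℂ((ζ))`. -/
def zeta : K := ((PowerSeries.X : PowerSeries ℂ) : LaurentSeries ℂ)

theorem zeta_eq : zeta = HahnSeries.single (1 : ℤ) (1 : ℂ) := HahnSeries.ofPowerSeries_X

theorem orderTop_zeta : zeta.orderTop = ((1 : ℤ) : WithTop ℤ) := by
  rw [zeta_eq, HahnSeries.orderTop_single one_ne_zero]

theorem zeta_ne_zero : zeta ≠ 0 := by
  rw [← HahnSeries.orderTop_ne_top, orderTop_zeta]
  exact WithTop.coe_ne_top

theorem coe_eval_recipPoly {d : ℕ} (hd : 1 ≤ d) (y : PowerSeries ℂ) :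
    (((recipPoly d).eval y : PowerSeries ℂ) : K) * treeT d ^ (2 * d - 1) =
      treeT d ^ (2 * d - 1) *
        ∑ i ∈ Finset.range (2 * d), zeta ^ (2 * i) * (y : K) ^ (2 * (2 * d - 1 - i)) -
      (y : K) ^ (2 * d - 1) := by
  have h : (((treeSeries d ^ (2 * d - 1))⁻¹ : PowerSeries ℂ) : K) * treeT d ^ (2 * d - 1) = 1 := by
    rw [← map_pow_treeT, ← map_mul, PowerSeries.inv_mul_cancel, map_one]
    simp [constantCoeff_treeSeries hd]
  simp only [recipPoly, Polynomial.eval_sub, Polynomial.eval_finsetSum, Polynomial.eval_mul,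
    Polynomial.eval_C, Polynomial.eval_pow, Polynomial.eval_X, map_sub, map_sum, map_mul, map_pow]
  rw [← zeta, sub_mul, mul_right_comm, ← map_pow, h]
  ring

/-- In terms of `y = ζ / x` the characteristic equation is the vanishing of `recipPoly`. -/
theorem isSmallRoot_zeta_div {d : ℕ} (hd : 1 ≤ d) {y : PowerSeries ℂ}
    (hy : PowerSeries.constantCoeff y ≠ 0) :
    IsSmallRoot d (zeta / (y : K)) ↔ (recipPoly d).eval y = 0 := by
  have hy0 : (y : K).orderTop = 0 := orderTop_coe_of_constantCoeff_ne_zero hy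
  have hyK : (y : K) ≠ 0 := by
    rw [← HahnSeries.orderTop_ne_top, hy0]
    exact WithTop.zero_ne_top
  have hx : zeta / (y : K) ≠ 0 := div_ne_zero zeta_ne_zero hyK
  have hpos : 0 < (zeta / (y : K)).orderTop := by
    have h := HahnSeries.orderTop_mul (zeta / (y : K)) (y : K)
    rw [div_mul_cancel₀ _ hyK, hy0, add_zero, orderTop_zeta] at h
    rw [← h]
    exact WithTop.coe_lt_coe.2 one_pos
  rw [isSmallRoot_iff hd hx, and_iff_right hpos]
  have hz : zVar d = zeta ^ (2 * d - 1) := map_pow (HahnSeries.ofPowerSeries ℤ ℂ) _ _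
  have hT := pow_ne_zero (2 * d - 1) (treeT_ne_zero hd)
  have h1 : (recipPoly d).eval y = 0 ↔
      (((recipPoly d).eval y : PowerSeries ℂ) : K) * treeT d ^ (2 * d - 1) = 0 := by
    rw [mul_eq_zero, or_iff_left hT, map_eq_zero_iff _ HahnSeries.ofPowerSeries_injective]
  have h2 : ∑ i ∈ Finset.range (2 * d), zeta ^ (2 * i) * (y : K) ^ (2 * (2 * d - 1 - i)) =
      (∑ i ∈ Finset.range (2 * d), (zeta / (y : K)) ^ (2 * i)) * (y : K) ^ (2 * (2 * d - 1)) := by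
    rw [Finset.sum_mul]
    refine Finset.sum_congr rfl fun i hi => ?_
    rw [Finset.mem_range] at hi
    rw [div_pow, div_mul_eq_mul_div, eq_div_iff (pow_ne_zero _ hyK), mul_assoc, ← pow_add]
    congr 2
    omega
  rw [h1, coe_eval_recipPoly hd, h2, bigZ, hz, sub_eq_zero, div_pow,
    div_eq_iff (pow_ne_zero _ hyK), mul_comm 2 (2 * d - 1), pow_mul]
  have hyN := pow_ne_zero (2 * d - 1) hyK
  have hzN := pow_ne_zero (2 * d - 1) zeta_ne_zero
  constructor
  · intro h
    refine mul_left_cancel₀ hzN ?_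
    linear_combination (-(y : K) ^ (2 * d - 1)) * h
  · intro h
    refine mul_left_cancel₀ hyN ?_
    linear_combination (-zeta ^ (2 * d - 1)) * h

/-- Since `x` has order `1`, the quotient `ζ / x` is a power series with nonzero constant term. -/
theorem IsSmallRoot.exists_eq_zeta_div {d : ℕ} (hd : 1 ≤ d) {x : K} (hx : IsSmallRoot d x) :
    ∃ y : PowerSeries ℂ, PowerSeries.constantCoeff y ≠ 0 ∧ x = zeta / (y : K) := by
  have hx0 := hx.ne_zero
  have ho : (zeta / x).orderTop = 0 := by
    have h := HahnSeries.orderTop_mul (zeta / x) x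
    rw [div_mul_cancel₀ _ hx0, hx.orderTop_eq hd, orderTop_zeta] at h
    obtain ⟨m, hm⟩ := WithTop.ne_top_iff_exists.1
      (HahnSeries.orderTop_ne_top.2 (div_ne_zero zeta_ne_zero hx0))
    rw [← hm, ← WithTop.coe_add, WithTop.coe_inj] at h
    rw [← hm, ← WithTop.coe_zero, WithTop.coe_inj]
    omega
  obtain ⟨y, hy⟩ := (LaurentSeries.val_le_one_iff_eq_coe ℂ (zeta / x)).1 (by
    have := (LaurentSeries.valuation_le_iff_coeff_lt_eq_zero ℂ (D := 0) (f := zeta / x)).2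
      fun n hn => HahnSeries.coeff_eq_zero_of_lt_orderTop (by
        rw [ho]; exact_mod_cast hn)
    simpa using this)
  refine ⟨y, ?_, ?_⟩
  · intro h0
    have h1 := LaurentSeries.coeff_coe_powerSeries y 0
    rw [PowerSeries.coeff_zero_eq_constantCoeff_apply, h0, hy] at h1
    exact HahnSeries.coeff_orderTop_ne (g := (0 : ℤ)) ho h1
  · rw [hy, div_div_cancel₀ zeta_ne_zero]

theorem ncard_smallRoots {d : ℕ} (hd : 1 ≤ d) : {x : K | IsSmallRoot d x}.ncard = 2 * d - 1 := by
  choose! y hy hyc using fun (c : ℂ) (hc : c ^ (2 * d - 1) = 1) => exists_recipPoly_root hd hc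
  have hN : 0 < 2 * d - 1 := by omega
  have hne : ∀ c : ℂ, c ^ (2 * d - 1) = 1 → c ≠ 0 := by
    rintro c hc rfl
    rw [zero_pow hN.ne'] at hc
    exact zero_ne_one hc
  have himg : {x : K | IsSmallRoot d x} =
      (fun c => zeta / (y c : K)) '' (Polynomial.nthRootsFinset (2 * d - 1) (1 : ℂ) : Set ℂ) := by
    ext x
    simp only [Set.mem_ofPred_eq, Set.mem_image, SetLike.mem_coe, Polynomial.mem_nthRootsFinset hN]
    constructor
    · intro hx
      obtain ⟨w, hw, rfl⟩ := hx.exists_eq_zeta_div hd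
      have hw1 := (isSmallRoot_zeta_div hd hw).1 hx
      have hwc : PowerSeries.constantCoeff w ^ (2 * d - 1) = 1 := by
        have h := constantCoeff_eval_recipPoly hd w
        rw [hw1, map_zero, two_mul, pow_add] at h
        refine mul_left_cancel₀ (pow_ne_zero (2 * d - 1) hw) ?_
        linear_combination -h
      refine ⟨_, hwc, ?_⟩
      rw [recipPoly_root_unique hd hw1 (hy _ hwc) hwc (hyc _ hwc).symm]
      rw [hyc _ hwc]
    · rintro ⟨c, hc, rfl⟩
      exact (isSmallRoot_zeta_div hd (by rw [hyc c hc]; exact hne c hc)).2 (hy c hc)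
  rw [himg, Set.InjOn.ncard_image, Set.ncard_coe_finset]
  · exact (Complex.isPrimitiveRoot_exp _ hN.ne').card_nthRootsFinset
  · intro c hc c' hc' h
    simp only [SetLike.mem_coe, Polynomial.mem_nthRootsFinset hN] at hc hc'
    have h1 : (y c : K) = y c' := by
      have := congrArg (zeta / ·) h
      simpa only [div_div_cancel₀ zeta_ne_zero] using this
    rw [← hyc c hc, ← hyc c' hc', HahnSeries.ofPowerSeries_injective h1]

/-! ### The recurrence as an identity of formal power series -/

section

variable {d : ℕ} {X : Fin (2 * d - 1) → K}

theorem monom_ne_zero (hX : ∀ l, X l ≠ 0) (m : ℤ) (n : MultiIndex d) : monom X m n ≠ 0 :=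
  Finset.prod_ne_zero_iff.2 fun l _ => zpow_ne_zero _ (hX l)

theorem monom_add_left (hX : ∀ l, X l ≠ 0) (m m' : ℤ) (n : MultiIndex d) :
    monom X (m + m') n = monom X m n * monom X m' n := by
  simp only [monom, add_mul, zpow_add₀ (hX _), Finset.prod_mul_distrib]

theorem monom_add_right (hX : ∀ l, X l ≠ 0) (m : ℤ) (n n' : MultiIndex d) :
    monom X m (n + n') = monom X m n * monom X m n' := by
  simp only [monom, Finsupp.add_apply, Nat.cast_add, mul_add, zpow_add₀ (hX _),
    Finset.prod_mul_distrib]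

theorem monom_zero_right (m : ℤ) : monom X m 0 = 1 := by
  simp [monom]

theorem monom_sum_right (hX : ∀ l, X l ≠ 0) (m : ℤ) {ι : Type*} (t : Finset ι)
    (g : ι → MultiIndex d) : monom X m (∑ i ∈ t, g i) = ∏ i ∈ t, monom X m (g i) := by
  classical
  induction t using Finset.induction_on with
  | empty => exact monom_zero_right m
  | insert a t ha ih =>
    rw [Finset.sum_insert ha, Finset.prod_insert ha, monom_add_right hX, ih]

theorem monom_single (m : ℤ) (l : Fin (2 * d - 1)) (k : ℕ) :
    monom X m (Finsupp.single l k) = X l ^ (m * (k : ℤ)) := by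
  rw [monom, Finset.prod_eq_single_of_mem l (Finset.mem_univ l), Finsupp.single_eq_same]
  intro i _ hi
  rw [Finsupp.single_eq_of_ne hi, Nat.cast_zero, mul_zero, zpow_zero]

theorem recFactor_eq (n : MultiIndex d) :
    recFactor X n = -1 / bigZ d + ∑ b ∈ stepSet d, monom X b n := by
  rw [recFactor, sum_stepSet d fun b => monom X b n]

/-- The sum over `𝐠` in the recurrence, for a fixed set `b` of steps. -/
def stepSum (X : Fin (2 * d - 1) → K) (α : MultiIndex d → K) (n : MultiIndex d) (b : Finset ℤ) :
    K :=
  ∑ g ∈ (Finset.piAntidiag b n).filter (fun g => ∀ i ∈ b, g i ≠ 0),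
    ∏ i ∈ b, α (g i) * monom X i (g i)

theorem recRHS_eq (α : MultiIndex d → K) (n : MultiIndex d) :
    recRHS X α n = ∑ k ∈ Finset.Icc 2 (2 * d), (-1) ^ k *
      ∑ b ∈ (stepSet d).powersetCard k, stepSum X α n b := by
  unfold recRHS stepSum
  congr!

/-- If `n` is a sum of at least two nonzero multi-indices, then each of them is less than `n`. -/
theorem lt_of_sum_eq {n : MultiIndex d} {b : Finset ℤ} (hb : 2 ≤ b.card) {g : ℤ → MultiIndex d}
    (hsum : b.sum g = n) (hne : ∀ i ∈ b, g i ≠ 0) {i : ℤ} (hi : i ∈ b) : g i < n := by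
  obtain ⟨k, hk, hki⟩ := Finset.exists_mem_ne hb i
  have hle : g i + g k ≤ n := by
    rw [← hsum, ← Finset.sum_pair hki.symm]
    exact Finset.sum_le_sum_of_subset (Finset.insert_subset hi (Finset.singleton_subset_iff.2 hk))
  refine lt_of_lt_of_le ?_ hle
  exact lt_add_of_pos_right _ (pos_iff_ne_zero.2 (hne k hk))

theorem stepSum_congr {α β : MultiIndex d → K} {n : MultiIndex d} {b : Finset ℤ}
    (hb : 2 ≤ b.card) (h : ∀ m < n, α m = β m) : stepSum X α n b = stepSum X β n b := by
  refine Finset.sum_congr rfl fun g hg => Finset.prod_congr rfl fun i hi => ?_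
  rw [Finset.mem_filter, Finset.mem_piAntidiag] at hg
  rw [h _ (lt_of_sum_eq hb hg.1.1 hg.2 hi)]

/-- The right-hand side of the recurrence at `n` involves only coefficients at multi-indices
`m < n`. -/
theorem recRHS_congr {α β : MultiIndex d → K} {n : MultiIndex d} (h : ∀ m < n, α m = β m) :
    recRHS X α n = recRHS X β n := by
  rw [recRHS_eq, recRHS_eq]
  refine Finset.sum_congr rfl fun k hk => congrArg _ (Finset.sum_congr rfl fun b hb => ?_)
  rw [Finset.mem_Icc] at hk
  rw [Finset.mem_powersetCard] at hb
  exact stepSum_congr (by omega) h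

theorem coeff_formalRho (α : MultiIndex d → K) (j : ℤ) (n : MultiIndex d) :
    MvPowerSeries.coeff n (formalRho X α j) = α n * monom X j n := rfl

/-- The condition `gᵢ ≠ 0` in `stepSum` may be dropped because `α 0 = 0`. -/
theorem coeff_prod_formalRho (hX : ∀ l, X l ≠ 0) {α : MultiIndex d → K} (h0 : α 0 = 0) (j : ℤ)
    (n : MultiIndex d) (b : Finset ℤ) :
    MvPowerSeries.coeff n (∏ i ∈ b, formalRho X α (j + i)) = monom X j n * stepSum X α n b := by
  rw [MvPowerSeries.coeff_prod]
  simp only [coeff_formalRho]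
  rw [sum_finsuppAntidiag_eq_sum_piAntidiag b n
      fun g : ℤ → MultiIndex d => ∏ i ∈ b, α (g i) * monom X (j + i) (g i),
    stepSum, Finset.mul_sum, Finset.sum_filter]
  refine Finset.sum_congr rfl fun g hg => ?_
  rw [Finset.mem_piAntidiag] at hg
  split_ifs with h
  · rw [← hg.1, monom_sum_right hX, ← Finset.prod_mul_distrib]
    refine Finset.prod_congr rfl fun i _ => ?_
    rw [monom_add_left hX]
    ring
  · push Not at h
    obtain ⟨i, hi, hgi⟩ := h
    refine Finset.prod_eq_zero hi ?_
    rw [hgi, h0, zero_mul]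

theorem coeff_prod_one_sub_formalRho (hX : ∀ l, X l ≠ 0) (hd : 1 ≤ d) {α : MultiIndex d → K}
    (h0 : α 0 = 0) (j : ℤ) (n : MultiIndex d) :
    MvPowerSeries.coeff n (∏ b ∈ stepSet d, (1 - formalRho X α (j + b))) =
      MvPowerSeries.coeff n (1 : MvPowerSeries (Fin (2 * d - 1)) K) -
        α n * ∑ b ∈ stepSet d, monom X (j + b) n + monom X j n * recRHS X α n := by
  have h : ∏ b ∈ stepSet d, (1 - formalRho X α (j + b)) =
      ∑ k ∈ Finset.range (2 * d + 1), MvPowerSeries.C ((-1 : K) ^ k) *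
        ∑ b ∈ (stepSet d).powersetCard k, ∏ i ∈ b, formalRho X α (j + i) := by
    rw [Finset.prod_sub, Finset.sum_powerset, card_stepSet]
    refine Finset.sum_congr rfl fun k _ => ?_
    rw [Finset.mul_sum]
    refine Finset.sum_congr rfl fun b hb => ?_
    rw [Finset.mem_powersetCard] at hb
    simp [hb.2]
  have h2 : Finset.Icc 2 (2 * d) = (Finset.range (2 * d + 1)).filter (2 ≤ ·) := by
    ext k
    simp only [Finset.mem_Icc, Finset.mem_filter, Finset.mem_range]
    omega
  have h1 : (Finset.range (2 * d + 1)).filter (¬ 2 ≤ ·) = {0, 1} := by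
    ext k
    simp only [Finset.mem_insert, Finset.mem_singleton, Finset.mem_filter, Finset.mem_range]
    omega
  rw [h, ← Finset.sum_filter_add_sum_filter_not _ (2 ≤ ·), ← h2, h1,
    Finset.sum_pair zero_ne_one, recRHS_eq, add_comm, map_add, map_add]
  congr 1
  · rw [Finset.powersetCard_zero, Finset.powersetCard_one, Finset.sum_map]
    simp only [pow_zero, pow_one, map_one, one_mul, Finset.sum_singleton, Finset.prod_empty,
      Function.Embedding.coeFn_mk, Finset.prod_singleton, MvPowerSeries.coeff_C_mul, map_sum,
      coeff_formalRho]
    rw [← Finset.mul_sum]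
    ring
  · rw [map_sum, Finset.mul_sum]
    refine Finset.sum_congr rfl fun k _ => ?_
    rw [MvPowerSeries.coeff_C_mul, map_sum]
    simp only [coeff_prod_formalRho hX h0]
    rw [← Finset.mul_sum]
    ring

/-- The recurrence at `n` is the equation between the coefficients of `𝐰 ^ n` in
`1 - ρⱼ = 1 - Z + Z ∏_b (1 - ρⱼ₊ᵦ)`, for any `j`. -/
theorem coeff_eq_iff_recurrenceAt (hX : ∀ l, X l ≠ 0) (hd : 1 ≤ d) {α : MultiIndex d → K}
    (h0 : α 0 = 0) (j : ℤ) (n : MultiIndex d) :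
    MvPowerSeries.coeff n (1 - formalRho X α j) =
      MvPowerSeries.coeff n (MvPowerSeries.C (1 - bigZ d) +
        MvPowerSeries.C (bigZ d) * ∏ b ∈ stepSet d, (1 - formalRho X α (j + b))) ↔
    RecurrenceAt X α n := by
  have hZ := bigZ_ne_zero hd
  have hm := monom_ne_zero hX j n
  have hsum : ∑ b ∈ stepSet d, monom X (j + b) n =
      monom X j n * ∑ b ∈ stepSet d, monom X b n := by
    simp only [monom_add_left hX, Finset.mul_sum]
  rw [RecurrenceAt, recFactor_eq, map_add, MvPowerSeries.coeff_C_mul,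
    coeff_prod_one_sub_formalRho hX hd h0, hsum, map_sub, coeff_formalRho,
    ← mul_one (MvPowerSeries.C (1 - bigZ d)), MvPowerSeries.coeff_C_mul]
  set e := MvPowerSeries.coeff n (1 : MvPowerSeries (Fin (2 * d - 1)) K)
  set S := ∑ b ∈ stepSet d, monom X b n
  constructor
  · intro h
    refine mul_left_cancel₀ (mul_ne_zero hZ hm) ?_
    have : bigZ d * (-1 / bigZ d) = -1 := by field_simp
    linear_combination h + α n * monom X j n * this
  · intro h
    have : bigZ d * (-1 / bigZ d) = -1 := by field_simp
    linear_combination bigZ d * monom X j n * h - α n * monom X j n * this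

/-- The `2d`-ary recurrence for `T (1 - ρⱼ)` follows from the recurrence for the coefficients. -/
theorem formalT_eq (hX : ∀ l, X l ≠ 0) (hd : 1 ≤ d) {α : MultiIndex d → K} (h0 : α 0 = 0)
    (h : ∀ n, RecurrenceAt X α n) (j : ℤ) :
    formalT X α j = 1 + MvPowerSeries.C (zVar d) * ∏ l ∈ Finset.Icc 1 d,
      (formalT X α (j + 2 * (l : ℤ) - 1) * formalT X α (j - 2 * (l : ℤ) + 1)) := by
  have h1 : 1 - formalRho X α j = MvPowerSeries.C (1 - bigZ d) +
      MvPowerSeries.C (bigZ d) * ∏ b ∈ stepSet d, (1 - formalRho X α (j + b)) :=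
    MvPowerSeries.ext fun n => (coeff_eq_iff_recurrenceAt hX hd h0 j n).2 (h n)
  have h2 : ∏ l ∈ Finset.Icc 1 d,
      (formalT X α (j + 2 * (l : ℤ) - 1) * formalT X α (j - 2 * (l : ℤ) + 1)) =
      MvPowerSeries.C (treeT d ^ (2 * d)) * ∏ b ∈ stepSet d, (1 - formalRho X α (j + b)) := by
    have h3 := prod_stepSet d fun b => formalT X α (j + b)
    have h4 : ∏ b ∈ stepSet d, formalT X α (j + b) = MvPowerSeries.C (treeT d ^ (2 * d)) *
        ∏ b ∈ stepSet d, (1 - formalRho X α (j + b)) := by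
      simp only [formalT]
      rw [Finset.prod_mul_distrib, Finset.prod_const, card_stepSet, map_pow]
    rw [← h4, h3]
    refine Finset.prod_congr rfl fun l _ => ?_
    congr 2 <;> ring
  have h5 := congrArg (MvPowerSeries.C (σ := Fin (2 * d - 1))) (treeT_eq hd)
  have h6 := congrArg (MvPowerSeries.C (σ := Fin (2 * d - 1))) (treeT_eq_bigZ hd)
  have h7 : zVar d * treeT d ^ (2 * d) = bigZ d * treeT d := by
    rw [bigZ, mul_assoc, ← pow_succ, show 2 * d - 1 + 1 = 2 * d by omega]
  have h8 := congrArg (MvPowerSeries.C (σ := Fin (2 * d - 1))) h7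
  rw [h2, formalT, h1]
  simp only [map_add, map_mul, map_one, map_sub] at h6 h8 ⊢
  linear_combination h6 -
    (∏ b ∈ stepSet d, (1 - formalRho X α (j + b))) * h8

end

/-! ### The explicit solution with one parameter -/

section

variable {d : ℕ} {x : K}

/-- The linear factor `1 - s xᵉ w` in the product formula for `1 - ρⱼ`. -/
def linFactor (s x : K) (e : ℤ) : PowerSeries K :=
  1 - PowerSeries.C (s * x ^ e) * PowerSeries.X

theorem linFactor_ne_zero (s x : K) (e : ℤ) : linFactor s x e ≠ 0 := by
  intro h
  have := congrArg PowerSeries.constantCoeff h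
  simp [linFactor] at this

theorem linFactor_mul (s x : K) (e e' : ℤ) :
    linFactor s x e * linFactor s x e' = 1 - PowerSeries.C (s * (x ^ e + x ^ e')) * PowerSeries.X +
      PowerSeries.C (s ^ 2 * (x ^ e * x ^ e')) * PowerSeries.X ^ 2 := by
  simp only [linFactor, map_mul, map_add, map_pow]
  ring

theorem geom_mul_linFactor (s : K) :
    PowerSeries.mk (fun m => s ^ m) * (1 - PowerSeries.C s * PowerSeries.X) = 1 := by
  refine PowerSeries.ext fun n => ?_
  rw [mul_sub, mul_one, ← mul_assoc, map_sub]
  cases n with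
  | zero => simp
  | succ n =>
    rw [PowerSeries.coeff_succ_mul_X, mul_comm, PowerSeries.coeff_C_mul, PowerSeries.coeff_mk,
      PowerSeries.coeff_mk, PowerSeries.coeff_one, if_neg (Nat.succ_ne_zero n)]
    ring

/-- The coefficient `α_{m 𝐞ₗ}` for `x = Xₗ` and `a = α_{𝐞ₗ}`. -/
def axisCoeff (d : ℕ) (x a : K) : ℕ → K
  | 0 => 0
  | m + 1 => a ^ (m + 1) * x ^ (2 * m) * (1 - x ^ ((m + 1) * (2 * d - 1))) /
      ((1 - x ^ (2 * d - 1)) * (1 - x ^ 2) ^ m * (1 - x ^ (2 * d + 1)) ^ m)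

/-- `1 - ρ_b` for the one-parameter solution. -/
def axisSeries (d : ℕ) (x a : K) (b : ℤ) : PowerSeries K :=
  1 - PowerSeries.mk fun m => axisCoeff d x a m * x ^ (b * (m : ℤ))

/-- The constant `c` for which the one-parameter solution is made up of geometric progressions of
ratios `a c` and `a c x ^ (2d - 1)`. -/
def axisRatio (d : ℕ) (x : K) : K := x ^ 2 / ((1 - x ^ 2) * (1 - x ^ (2 * d + 1)))

/-- Up to a constant, the coefficients of the one-parameter solution are the difference of two
geometric progressions. -/
theorem axisCoeff_eq (hx0 : x ≠ 0) (hx : 0 < x.orderTop) (hd : 1 ≤ d) (a : K) (m : ℕ) :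
    axisCoeff d x a m = ((a * axisRatio d x) ^ m - (a * axisRatio d x * x ^ (2 * d - 1)) ^ m) /
      (axisRatio d x * (1 - x ^ (2 * d - 1))) := by
  have h1 := one_sub_ne_zero_of_orderTop_pos (orderTop_pow_pos hx (n := 2 * d - 1) (by omega))
  have h2 := one_sub_ne_zero_of_orderTop_pos (orderTop_pow_pos hx (n := 2) (by omega))
  have h3 := one_sub_ne_zero_of_orderTop_pos (orderTop_pow_pos hx (n := 2 * d + 1) (by omega))
  cases m with
  | zero => simp [axisCoeff]
  | succ m =>
    rw [axisCoeff, axisRatio, mul_comm (m + 1) (2 * d - 1), pow_mul x (2 * d - 1)]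
    generalize x ^ (2 * d - 1) = y at *
    generalize x ^ (2 * d + 1) = u at *
    rw [pow_mul x 2]
    have h4 : x ^ 2 ≠ 0 := pow_ne_zero 2 hx0
    generalize x ^ 2 = v at *
    rw [mul_pow (a * _) y, mul_pow a, div_pow, pow_succ v, pow_succ (_ * _), mul_pow]
    field_simp

/-- Summing the geometric progressions gives a product formula for `1 - ρ_b`. -/
theorem axisSeries_mul (hx0 : x ≠ 0) (hx : 0 < x.orderTop) (hd : 1 ≤ d) (a : K) (b : ℤ) :
    axisSeries d x a b * (linFactor (a * axisRatio d x) x b *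
        linFactor (a * axisRatio d x) x (b + (2 * d - 1))) =
      linFactor (a * axisRatio d x) x (b - 2) *
        linFactor (a * axisRatio d x) x (b + (2 * d + 1)) := by
  have h1 := one_sub_ne_zero_of_orderTop_pos (orderTop_pow_pos hx (n := 2 * d - 1) (by omega))
  have h2 := one_sub_ne_zero_of_orderTop_pos (orderTop_pow_pos hx (n := 2) (by omega))
  have h3 := one_sub_ne_zero_of_orderTop_pos (orderTop_pow_pos hx (n := 2 * d + 1) (by omega))
  have hc : axisRatio d x ≠ 0 := div_ne_zero (pow_ne_zero 2 hx0) (mul_ne_zero h2 h3)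
  set s := a * axisRatio d x with hs
  set κ := (axisRatio d x * (1 - x ^ (2 * d - 1)))⁻¹ with hκ
  have hN : x ^ (2 * (d : ℤ) - 1) = x ^ (2 * d - 1) := by
    rw [← zpow_natCast, Nat.cast_sub (by omega)]
    push_cast
    rfl
  have hM : x ^ (2 * (d : ℤ) + 1) = x ^ (2 * d + 1) := by
    rw [← zpow_natCast]
    push_cast
    rfl
  have hmk : (PowerSeries.mk fun m => axisCoeff d x a m * x ^ (b * (m : ℤ))) =
      PowerSeries.C κ * (PowerSeries.mk (fun m => (s * x ^ b) ^ m) -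
        PowerSeries.mk (fun m => (s * x ^ (b + (2 * d - 1))) ^ m)) := by
    refine PowerSeries.ext fun m => ?_
    rw [PowerSeries.coeff_C_mul, map_sub, PowerSeries.coeff_mk, PowerSeries.coeff_mk,
      PowerSeries.coeff_mk, axisCoeff_eq hx0 hx hd, zpow_add₀ hx0, hN, zpow_mul, zpow_natCast,
      div_eq_mul_inv, ← hκ, ← hs]
    ring
  have g1 : _ * linFactor s x b = 1 := geom_mul_linFactor (s * x ^ b)
  have g2 : _ * linFactor s x (b + (2 * d - 1)) = 1 :=
    geom_mul_linFactor (s * x ^ (b + (2 * d - 1)))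
  have hlin : PowerSeries.C κ * (linFactor s x (b + (2 * d - 1)) - linFactor s x b) =
      PowerSeries.C (a * x ^ b) * PowerSeries.X := by
    have : κ * (s * x ^ b - s * x ^ (b + (2 * d - 1))) = a * x ^ b := by
      rw [zpow_add₀ hx0, hN, hκ, hs]
      field_simp
    rw [← this, linFactor, linFactor]
    simp only [map_mul, map_sub]
    ring
  have hprod : linFactor s x b * linFactor s x (b + (2 * d - 1)) -
      PowerSeries.C (a * x ^ b) * PowerSeries.X =
      linFactor s x (b - 2) * linFactor s x (b + (2 * d + 1)) := by
    -- This is where the value of `axisRatio` comes from: `1 / axisRatio` has to be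
    -- `x⁻² + x ^ (2d + 1) - 1 - x ^ (2d - 1)`.
    have e1 : s * (x ^ b + x ^ (b + (2 * (d : ℤ) - 1))) + a * x ^ b =
        s * (x ^ (b - 2) + x ^ (b + (2 * (d : ℤ) + 1))) := by
      rw [zpow_add₀ hx0, zpow_add₀ hx0, zpow_sub₀ hx0 b, hN, hM, hs, axisRatio,
        show 2 * d + 1 = 2 * d - 1 + 2 by omega, pow_add]
      rw [show 2 * d + 1 = 2 * d - 1 + 2 by omega, pow_add] at h3
      generalize x ^ (2 * d - 1) = y at *
      have h4 : 1 - x ^ 2 * y ≠ 0 := by rwa [mul_comm]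
      generalize x ^ b = t
      norm_cast
      field_simp
      ring
    have e2 : x ^ b * x ^ (b + (2 * (d : ℤ) - 1)) = x ^ (b - 2) * x ^ (b + (2 * (d : ℤ) + 1)) := by
      rw [← zpow_add₀ hx0, ← zpow_add₀ hx0]
      congr 1
      ring
    rw [linFactor_mul, linFactor_mul, ← e1, e2, map_add]
    ring
  rw [axisSeries, hmk, ← hprod, ← hlin]
  linear_combination (-PowerSeries.C κ * linFactor s x (b + (2 * d - 1))) * g1 +
    (PowerSeries.C κ * linFactor s x b) * g2

/-- The product formula telescopes over the step set. -/
theorem prod_axisSeries_mul (hx0 : x ≠ 0) (hx : 0 < x.orderTop) (hd : 1 ≤ d) (a : K) :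
    (∏ b ∈ stepSet d, axisSeries d x a b) * (linFactor (a * axisRatio d x) x 0 *
        linFactor (a * axisRatio d x) x (2 * d - 1)) =
      linFactor (a * axisRatio d x) x (-(2 * d + 1)) *
        linFactor (a * axisRatio d x) x (4 * d) := by
  set p := linFactor (a * axisRatio d x) x with hp
  have h1 : (∏ b ∈ stepSet d, p (b - 2)) * p (2 * d - 1) =
      (∏ b ∈ stepSet d, p b) * p (-(2 * d + 1)) := by
    have t := (Finset.prod_range_succ
      (fun i : ℕ => p (2 * (i : ℤ) - (2 * d + 1))) (2 * d)).symm.trans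
      (Finset.prod_range_succ' (fun i : ℕ => p (2 * (i : ℤ) - (2 * d + 1))) (2 * d))
    rw [prod_stepSet_range, prod_stepSet_range]
    convert t using 2
    · refine Finset.prod_congr rfl fun i _ => ?_
      exact congrArg p (by ring)
    · exact congrArg p (by push_cast; ring)
    · refine Finset.prod_congr rfl fun i _ => ?_
      exact congrArg p (by push_cast; ring)
    · exact congrArg p (by push_cast; ring)
  have h2 : (∏ b ∈ stepSet d, p (b + (2 * d - 1))) * p (4 * d) =
      (∏ b ∈ stepSet d, p (b + (2 * d + 1))) * p 0 := by
    have t := (Finset.prod_range_succ (fun i : ℕ => p (2 * (i : ℤ))) (2 * d)).symm.trans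
      (Finset.prod_range_succ' (fun i : ℕ => p (2 * (i : ℤ))) (2 * d))
    rw [prod_stepSet_range, prod_stepSet_range]
    convert t using 2
    · refine Finset.prod_congr rfl fun i _ => ?_
      exact congrArg p (by ring)
    · exact congrArg p (by push_cast; ring)
    · refine Finset.prod_congr rfl fun i _ => ?_
      exact congrArg p (by push_cast; ring)
    · simp
  have h3 := Finset.prod_congr (rfl : stepSet d = stepSet d)
    fun b _ => axisSeries_mul hx0 hx hd a b
  simp only [Finset.prod_mul_distrib, ← hp] at h3
  have hne : ∀ f : ℤ → ℤ, ∏ b ∈ stepSet d, p (f b) ≠ 0 := fun f =>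
    Finset.prod_ne_zero_iff.2 fun b _ => linFactor_ne_zero _ _ _
  refine mul_left_cancel₀ (mul_ne_zero (hne fun b => b) (hne fun b => b + (2 * d - 1))) ?_
  linear_combination p 0 * p (2 * d - 1) * h3 +
    p 0 * (∏ b ∈ stepSet d, p (b + (2 * d + 1))) * h1 -
    (∏ b ∈ stepSet d, p b) * p (-(2 * d + 1)) * h2

theorem IsSmallRoot.pow_mul_one_sub (hd : 1 ≤ d) (hx : IsSmallRoot d x) :
    x ^ (2 * d - 1) * (1 - x ^ 2) = bigZ d * (1 - x ^ (4 * d)) := by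
  have h := ((isSmallRoot_iff hd hx.ne_zero).1 hx).2
  have g := mul_neg_geom_sum (x ^ 2) (2 * d)
  simp only [← pow_mul] at g
  rw [show 4 * d = 2 * (2 * d) by ring, ← g, h]
  ring

/-- The one-parameter solution satisfies the normalized recurrence: after multiplication by the
denominators of the product formula this is an identity between polynomials of degree two, whose
linear coefficient is the characteristic equation. -/
theorem axisSeries_eq (hd : 1 ≤ d) (hx : IsSmallRoot d x) (a : K) :
    axisSeries d x a 0 = PowerSeries.C (1 - bigZ d) +
      PowerSeries.C (bigZ d) * ∏ b ∈ stepSet d, axisSeries d x a b := by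
  have hx0 := hx.ne_zero
  have h1 := axisSeries_mul hx0 hx.1 hd a 0
  have h2 := prod_axisSeries_mul hx0 hx.1 hd a
  rw [zero_add, zero_add, zero_sub] at h1
  set s := a * axisRatio d x
  have hquad : linFactor s x (-2) * linFactor s x (2 * d + 1) =
      PowerSeries.C (1 - bigZ d) * (linFactor s x 0 * linFactor s x (2 * d - 1)) +
        PowerSeries.C (bigZ d) * (linFactor s x (-(2 * d + 1)) * linFactor s x (4 * d)) := by
    have hchar := hx.pow_mul_one_sub hd
    have e1 : x ^ (-2 : ℤ) + x ^ (2 * (d : ℤ) + 1) =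
        (1 - bigZ d) * (x ^ (0 : ℤ) + x ^ (2 * (d : ℤ) - 1)) +
          bigZ d * (x ^ (-(2 * (d : ℤ) + 1)) + x ^ (4 * (d : ℤ))) := by
      have hM : x ^ (2 * (d : ℤ) + 1) = x ^ (2 * d - 1) * x ^ 2 := by
        rw [← pow_add, ← zpow_natCast, Nat.cast_add, Nat.cast_sub (by omega)]
        push_cast
        congr 1
        ring
      have hN : x ^ (2 * (d : ℤ) - 1) = x ^ (2 * d - 1) := by
        rw [← zpow_natCast, Nat.cast_sub (by omega)]
        push_cast
        rfl
      have h4 : x ^ (4 * (d : ℤ)) = x ^ (4 * d) := by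
        rw [← zpow_natCast]
        push_cast
        rfl
      have h5 : x ^ (4 * d) = (x ^ (2 * d - 1)) ^ 2 * x ^ 2 := by
        rw [← pow_mul, ← pow_add]
        congr 1
        omega
      rw [zpow_neg, zpow_neg, hM, hN, h4, zpow_zero]
      rw [h5] at hchar ⊢
      have hy : x ^ (2 * d - 1) ≠ 0 := pow_ne_zero _ hx0
      generalize x ^ (2 * d - 1) = y at *
      norm_cast
      field_simp
      linear_combination (1 - y * x ^ 2) * hchar
    have e2 : x ^ (-2 : ℤ) * x ^ (2 * (d : ℤ) + 1) = x ^ (0 : ℤ) * x ^ (2 * (d : ℤ) - 1) := by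
      rw [← zpow_add₀ hx0, ← zpow_add₀ hx0]
      congr 1
      ring
    have e3 : x ^ (-(2 * (d : ℤ) + 1)) * x ^ (4 * (d : ℤ)) =
        x ^ (0 : ℤ) * x ^ (2 * (d : ℤ) - 1) := by
      rw [← zpow_add₀ hx0, ← zpow_add₀ hx0]
      congr 1
      ring
    rw [linFactor_mul, linFactor_mul, linFactor_mul, e1, e2, e3]
    simp only [map_mul, map_add, map_sub, map_one, map_pow]
    ring
  refine mul_right_cancel₀ (mul_ne_zero (linFactor_ne_zero s x 0)
    (linFactor_ne_zero s x (2 * d - 1))) ?_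
  linear_combination h1 + hquad - PowerSeries.C (bigZ d) * h2

end

/-! ### The recurrence on the axes -/

section

variable {d : ℕ} {X : Fin (2 * d - 1) → K}

theorem eq_single_of_le {l : Fin (2 * d - 1)} {k : ℕ} {m : MultiIndex d}
    (h : m ≤ Finsupp.single l k) : m = Finsupp.single l (m l) := by
  refine Finsupp.ext fun i => ?_
  rcases eq_or_ne i l with rfl | hi
  · rw [Finsupp.single_eq_same]
  · have := h i
    rw [Finsupp.single_eq_of_ne hi] at this ⊢
    exact Nat.le_zero.1 this

/-- The family with the explicit coefficients on the `l`-th axis that vanishes elsewhere. -/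
def axisFamily (X : Fin (2 * d - 1) → K) (l : Fin (2 * d - 1)) (c : K) (n : MultiIndex d) : K :=
  if n = Finsupp.single l (n l) then axisCoeff d (X l) c (n l) else 0

theorem axisFamily_single (l : Fin (2 * d - 1)) (c : K) (m : ℕ) :
    axisFamily X l c (Finsupp.single l m) = axisCoeff d (X l) c m := by
  rw [axisFamily, Finsupp.single_eq_same, if_pos rfl]

theorem one_sub_formalRho_axisFamily (l : Fin (2 * d - 1)) (c : K) (b : ℤ) :
    1 - formalRho X (axisFamily X l c) b =
      (axisSeries d (X l) c b).subst (MvPowerSeries.X l : MvPowerSeries (Fin (2 * d - 1)) K) := by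
  have hs : PowerSeries.HasSubst (MvPowerSeries.X l : MvPowerSeries (Fin (2 * d - 1)) K) :=
    PowerSeries.HasSubst.X l
  rw [axisSeries, PowerSeries.subst_sub hs, ← PowerSeries.coe_substAlgHom hs, map_one,
    PowerSeries.coe_substAlgHom hs]
  congr 1
  refine MvPowerSeries.ext fun n => ?_
  rw [PowerSeries.coeff_subst_single, coeff_formalRho, axisFamily]
  split_ifs with h
  · rw [PowerSeries.coeff_mk]
    conv_lhs => rw [h]
    rw [monom_single, Finsupp.single_eq_same]
  · rw [zero_mul]

theorem axisFamily_recurrenceAt (hd : 1 ≤ d) (hX : ∀ l, IsSmallRoot d (X l))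
    (l : Fin (2 * d - 1)) (c : K) (n : MultiIndex d) :
    RecurrenceAt X (axisFamily X l c) n := by
  have hs : PowerSeries.HasSubst (MvPowerSeries.X l : MvPowerSeries (Fin (2 * d - 1)) K) :=
    PowerSeries.HasSubst.X l
  rw [← coeff_eq_iff_recurrenceAt (fun l => (hX l).ne_zero) hd (by simp [axisFamily, axisCoeff]) 0]
  congr 1
  simp only [zero_add, one_sub_formalRho_axisFamily]
  have h := congrArg (PowerSeries.substAlgHom (R := K) hs) (axisSeries_eq hd (hX l) c)
  rw [map_add, map_mul, map_prod] at h
  simpa only [PowerSeries.coe_substAlgHom, PowerSeries.subst_C] using h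

/-- At a multiple of a unit vector the recurrence involves only coefficients on the same axis, and
there it is the recurrence for the one-parameter solution. -/
theorem recurrenceAt_single (hd : 1 ≤ d) (hX : ∀ l, IsSmallRoot d (X l)) {α : MultiIndex d → K}
    {l : Fin (2 * d - 1)} {c : K} (h : ∀ m, α (Finsupp.single l m) = axisCoeff d (X l) c m)
    (k : ℕ) : RecurrenceAt X α (Finsupp.single l k) := by
  have h1 := axisFamily_recurrenceAt hd hX l c (Finsupp.single l k)
  have h2 : recRHS X α (Finsupp.single l k) =
      recRHS X (axisFamily X l c) (Finsupp.single l k) := by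
    refine recRHS_congr fun m hm => ?_
    rw [eq_single_of_le hm.le, h, axisFamily_single]
  rw [RecurrenceAt, h2, h, ← axisFamily_single]
  exact h1

theorem IsCoeffFamily.single {a : Fin (2 * d - 1) → K} {α : MultiIndex d → K}
    (hα : IsCoeffFamily X a α) (l : Fin (2 * d - 1)) (m : ℕ) :
    α (Finsupp.single l m) = axisCoeff d (X l) (a l) m := by
  cases m with
  | zero => rw [Finsupp.single_zero, hα.zero, axisCoeff]
  | succ m => exact hα.axis l m

theorem IsCoeffFamily.recurrenceAt (hd : 1 ≤ d) (hX : ∀ l, IsSmallRoot d (X l))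
    {a : Fin (2 * d - 1) → K} {α : MultiIndex d → K} (hα : IsCoeffFamily X a α)
    (n : MultiIndex d) : RecurrenceAt X α n := by
  by_cases h : ∀ l m, n ≠ Finsupp.single l m
  · exact hα.recurrence n h
  · push Not at h
    obtain ⟨l, m, rfl⟩ := h
    exact recurrenceAt_single hd hX (hα.single l) m

/-! ### Orders in `ζ` -/

theorem orderTop_inv {x : K} {m : ℤ} (hx : x.orderTop = m) :
    x⁻¹.orderTop = ((-m : ℤ) : WithTop ℤ) := by
  have hx0 : x ≠ 0 := by
    rw [← HahnSeries.orderTop_ne_top, hx]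
    exact WithTop.coe_ne_top
  obtain ⟨k, hk⟩ := WithTop.ne_top_iff_exists.1 (HahnSeries.orderTop_ne_top.2 (inv_ne_zero hx0))
  have h := HahnSeries.orderTop_mul x⁻¹ x
  rw [inv_mul_cancel₀ hx0, HahnSeries.orderTop_one, hx, ← hk, ← WithTop.coe_add,
    ← WithTop.coe_zero, WithTop.coe_inj] at h
  rw [← hk, WithTop.coe_inj]
  omega

theorem orderTop_zpow {x : K} {m : ℤ} (hx : x.orderTop = m) (k : ℤ) :
    (x ^ k).orderTop = ((k * m : ℤ) : WithTop ℤ) := by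
  have h (n : ℕ) : (x ^ n).orderTop = ((n * m : ℤ) : WithTop ℤ) := by
    rw [orderTop_pow, hx, ← WithTop.coe_nsmul, nsmul_eq_mul]
  cases k with
  | ofNat n => rw [Int.ofNat_eq_natCast, zpow_natCast, h]
  | negSucc n =>
    rw [zpow_negSucc, orderTop_inv (h _), WithTop.coe_inj, Int.negSucc_eq]
    push_cast
    ring

theorem sum_le_orderTop_prod {ι : Type*} (s : Finset ι) {f : ι → K} {e : ι → ℤ}
    (h : ∀ i ∈ s, (e i : WithTop ℤ) ≤ (f i).orderTop) :
    ((∑ i ∈ s, e i : ℤ) : WithTop ℤ) ≤ (∏ i ∈ s, f i).orderTop := by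
  classical
  induction s using Finset.induction_on with
  | empty => simp
  | insert a s ha ih =>
    rw [Finset.sum_insert ha, Finset.prod_insert ha, HahnSeries.orderTop_mul, WithTop.coe_add]
    exact add_le_add (h a (Finset.mem_insert_self a s))
      (ih fun i hi => h i (Finset.mem_insert_of_mem hi))

theorem orderTop_monom (hd : 1 ≤ d) (hX : ∀ l, IsSmallRoot d (X l)) (m : ℤ) (n : MultiIndex d) :
    (monom X m n).orderTop = ((m * (n.degree : ℤ) : ℤ) : WithTop ℤ) := by
  have h : monom X m n = ∏ l, (X l ^ m) ^ n l :=
    Finset.prod_congr rfl fun l _ => by rw [zpow_mul, zpow_natCast]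
  have h1 (s : Finset (Fin (2 * d - 1))) :
      (∏ l ∈ s, (X l ^ m) ^ n l).orderTop = ((m * ∑ l ∈ s, (n l : ℤ) : ℤ) : WithTop ℤ) := by
    induction s using Finset.induction_on with
    | empty => simp
    | insert a s ha ih =>
      rw [Finset.prod_insert ha, HahnSeries.orderTop_mul, ih, Finset.sum_insert ha, orderTop_pow,
        orderTop_zpow ((hX a).orderTop_eq hd), ← WithTop.coe_nsmul, ← WithTop.coe_add,
        nsmul_eq_mul, WithTop.coe_inj]
      ring
  rw [h, h1, Finsupp.degree_eq_sum, Nat.cast_sum]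

theorem two_le_degree (hd : 1 ≤ d) {n : MultiIndex d} (hn : ∀ l m, n ≠ Finsupp.single l m) :
    2 ≤ n.degree := by
  have h0 : n ≠ 0 := fun h => hn ⟨0, by omega⟩ 0 (by rw [h, Finsupp.single_zero])
  obtain ⟨l, hl⟩ := Finsupp.ne_iff.1 h0
  obtain ⟨i, hi⟩ := Finsupp.ne_iff.1 (hn l (n l))
  have hil : i ≠ l := by
    rintro rfl
    exact hi (Finsupp.single_eq_same).symm
  rw [Finsupp.single_eq_of_ne hil] at hi
  rw [Finsupp.zero_apply] at hl
  rw [Finsupp.degree_eq_sum]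
  have h1 : ∑ k ∈ {i, l}, n k ≤ ∑ k, n k := Finset.sum_le_sum_of_subset (Finset.subset_univ _)
  rw [Finset.sum_pair hil] at h1
  omega

/-- For `|n| ≥ 2` the monomial with the most negative exponent dominates the factor on the left of
the recurrence; for `|n| = 1` it cancels against `-1 / Z`. -/
theorem orderTop_recFactor (hd : 1 ≤ d) (hX : ∀ l, IsSmallRoot d (X l)) {n : MultiIndex d}
    (hn : 2 ≤ n.degree) :
    (recFactor X n).orderTop = ((-(2 * (d : ℤ) - 1) * (n.degree : ℤ) : ℤ) : WithTop ℤ) := by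
  have hmem : -(2 * (d : ℤ) - 1) ∈ stepSet d :=
    Finset.mem_image.2 ⟨0, Finset.mem_range.2 (by omega), by push_cast; ring⟩
  have hn' : (2 : ℤ) ≤ (n.degree : ℤ) := by exact_mod_cast hn
  have hd' : (1 : ℤ) ≤ (d : ℤ) := by exact_mod_cast hd
  rw [recFactor_eq, ← Finset.add_sum_erase _ _ hmem, add_left_comm, ← orderTop_monom hd hX]
  refine (HahnSeries.addVal ℤ ℂ).map_add_eq_of_lt_left ?_
  rw [HahnSeries.addVal_apply, orderTop_monom hd hX]
  refine (HahnSeries.addVal ℤ ℂ).map_lt_add ?_ ?_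
  · rw [HahnSeries.addVal_apply, div_eq_mul_inv, HahnSeries.orderTop_mul, HahnSeries.orderTop_neg,
      HahnSeries.orderTop_one, zero_add, orderTop_inv (orderTop_bigZ hd), WithTop.coe_lt_coe,
      Nat.cast_sub (by omega)]
    push_cast
    nlinarith
  · refine (HahnSeries.addVal ℤ ℂ).map_lt_sum WithTop.coe_ne_top fun b hb => ?_
    rw [HahnSeries.addVal_apply, orderTop_monom hd hX, WithTop.coe_lt_coe]
    rw [Finset.mem_erase, stepSet, Finset.mem_image] at hb
    obtain ⟨hb, i, -, rfl⟩ := hb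
    refine mul_lt_mul_of_pos_right ?_ (by omega)
    omega

theorem recFactor_ne_zero (hd : 1 ≤ d) (hX : ∀ l, IsSmallRoot d (X l)) {n : MultiIndex d}
    (hn : 2 ≤ n.degree) : recFactor X n ≠ 0 := by
  rw [← HahnSeries.orderTop_ne_top, orderTop_recFactor hd hX hn]
  exact WithTop.coe_ne_top

theorem orderTop_one_sub_pow {x : K} (hx : 0 < x.orderTop) {k : ℕ} (hk : k ≠ 0) :
    (1 - x ^ k).orderTop = 0 := by
  rw [sub_eq_add_neg]
  refine orderTop_one_add ?_
  rw [HahnSeries.orderTop_neg]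
  exact orderTop_pow_pos hx hk

theorem le_orderTop_axisCoeff (hd : 1 ≤ d) {x : K} (hx : IsSmallRoot d x) {c : K} {A : ℤ}
    (hA : (A : WithTop ℤ) ≤ c.orderTop) (m : ℕ) :
    ((A * (m : ℤ) + 2 * ((m : ℤ) - 1) : ℤ) : WithTop ℤ) ≤ (axisCoeff d x c m).orderTop := by
  cases m with
  | zero => simp [axisCoeff]
  | succ m =>
    have hden : ((1 - x ^ (2 * d - 1)) * (1 - x ^ 2) ^ m * (1 - x ^ (2 * d + 1)) ^ m).orderTop =
        ((0 : ℤ) : WithTop ℤ) := by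
      rw [HahnSeries.orderTop_mul, HahnSeries.orderTop_mul, orderTop_pow, orderTop_pow,
        orderTop_one_sub_pow hx.1 (by omega), orderTop_one_sub_pow hx.1 (by omega),
        orderTop_one_sub_pow hx.1 (by omega)]
      simp
    rw [axisCoeff, div_eq_mul_inv, HahnSeries.orderTop_mul, orderTop_inv hden,
      HahnSeries.orderTop_mul, HahnSeries.orderTop_mul, orderTop_pow, orderTop_pow,
      orderTop_one_sub_pow hx.1 (Nat.mul_ne_zero (by omega) (by omega)), hx.orderTop_eq hd,
      neg_zero, WithTop.coe_zero, add_zero, add_zero]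
    have h1 : (((m + 1) • A + (2 * m) • 1 : ℤ) : WithTop ℤ) ≤
        (m + 1) • c.orderTop + (2 * m) • ((1 : ℤ) : WithTop ℤ) := by
      rw [WithTop.coe_add, WithTop.coe_nsmul, WithTop.coe_nsmul]
      exact add_le_add (nsmul_le_nsmul_right hA _) le_rfl
    refine le_trans (le_of_eq (WithTop.coe_inj.2 ?_)) h1
    simp only [nsmul_eq_mul]
    push_cast
    ring

/-- If every `a_l` has order at least `A`, then `α_n` has order at least `A |n| + 2 (|n| - 1)`. In
the induction, a product over `k` steps `b` loses `2 (k - 1)` in the terms `2 (|g_b| - 1)`, which is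
made up for by the gain `∑ (b + 2d - 1) |g_b|`: all but one of the steps are at least
`-(2d - 1) + 2`. -/
theorem IsCoeffFamily.le_orderTop (hd : 1 ≤ d) (hX : ∀ l, IsSmallRoot d (X l))
    {a : Fin (2 * d - 1) → K} {α : MultiIndex d → K} (hα : IsCoeffFamily X a α) {A : ℤ}
    (hA : ∀ l, (A : WithTop ℤ) ≤ (a l).orderTop) (n : MultiIndex d) :
    ((A * (n.degree : ℤ) + 2 * ((n.degree : ℤ) - 1) : ℤ) : WithTop ℤ) ≤ (α n).orderTop := by
  induction n using WellFoundedLT.induction with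
  | _ n ih =>
  by_cases hn : ∀ l m, n ≠ Finsupp.single l m
  swap
  · push Not at hn
    obtain ⟨l, m, rfl⟩ := hn
    rw [hα.single, Finsupp.degree_single]
    exact le_orderTop_axisCoeff hd (hX l) (hA l) m
  have hdeg := two_le_degree hd hn
  have hF := orderTop_recFactor hd hX hdeg
  have hrhs : ((A * (n.degree : ℤ) + 2 * ((n.degree : ℤ) - 1) -
      (2 * (d : ℤ) - 1) * (n.degree : ℤ) : ℤ) : WithTop ℤ) ≤ (recRHS X α n).orderTop := by
    rw [recRHS_eq]
    refine (HahnSeries.addVal ℤ ℂ).map_le_sum fun k hk => ?_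
    rw [HahnSeries.addVal_apply, HahnSeries.orderTop_mul, orderTop_pow, HahnSeries.orderTop_neg,
      HahnSeries.orderTop_one, smul_zero, zero_add]
    refine (HahnSeries.addVal ℤ ℂ).map_le_sum fun b hb => ?_
    refine (HahnSeries.addVal ℤ ℂ).map_le_sum fun g hg => ?_
    rw [Finset.mem_Icc] at hk
    rw [Finset.mem_powersetCard] at hb
    rw [Finset.mem_filter, Finset.mem_piAntidiag] at hg
    obtain ⟨⟨hsum, -⟩, hne⟩ := hg
    have hterm : ∀ i ∈ b, ((A * ((g i).degree : ℤ) + 2 * (((g i).degree : ℤ) - 1) +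
        i * ((g i).degree : ℤ) : ℤ) : WithTop ℤ) ≤ (α (g i) * monom X i (g i)).orderTop := by
      intro i hi
      rw [HahnSeries.orderTop_mul, orderTop_monom hd hX, WithTop.coe_add]
      exact add_le_add (ih (g i) (lt_of_sum_eq (by omega) hsum hne hi)) le_rfl
    refine le_trans (WithTop.coe_le_coe.2 ?_) (sum_le_orderTop_prod b hterm)
    have hD : (n.degree : ℤ) = ∑ i ∈ b, ((g i).degree : ℤ) := by
      rw [← hsum, map_sum, Nat.cast_sum]
    -- Only the step `-(2d - 1)` can have a negative summand, and that summand is `-2`.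
    have hgain : (-2 : ℤ) ≤
        ∑ i ∈ b, ((i + (2 * (d : ℤ) - 1)) * ((g i).degree : ℤ) - 2) := by
      refine le_trans ?_ (Finset.sum_le_sum
        (f := fun i : ℤ => if i = -(2 * (d : ℤ) - 1) then (-2 : ℤ) else 0) fun i hi => ?_)
      · rw [Finset.sum_ite_eq']
        split_ifs <;> norm_num
      · have hpos : (1 : ℤ) ≤ ((g i).degree : ℤ) := by
          have : (g i).degree ≠ 0 := fun h => hne i hi ((Finsupp.degree_eq_zero_iff _).1 h)
          omega
        have hi' := hb.1 hi
        rw [stepSet, Finset.mem_image] at hi'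
        obtain ⟨r, -, rfl⟩ := hi'
        split_ifs with h
        · rw [h]; simp
        · have : (2 : ℤ) ≤ 2 * (r : ℤ) - (2 * (d : ℤ) - 1) + (2 * (d : ℤ) - 1) := by omega
          nlinarith
    have hsplit : ∑ i ∈ b, (A * ((g i).degree : ℤ) + 2 * (((g i).degree : ℤ) - 1) +
        i * ((g i).degree : ℤ)) = (A + 2 - (2 * (d : ℤ) - 1)) * ∑ i ∈ b, ((g i).degree : ℤ) +
          ∑ i ∈ b, ((i + (2 * (d : ℤ) - 1)) * ((g i).degree : ℤ) - 2) := by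
      rw [Finset.mul_sum, ← Finset.sum_add_distrib]
      exact Finset.sum_congr rfl fun i _ => by ring
    rw [hsplit, ← hD]
    linarith
  rw [← hα.recurrence n hn, HahnSeries.orderTop_mul, hF] at hrhs
  cases h : (α n).orderTop with
  | top => exact le_top
  | coe v =>
    rw [h, ← WithTop.coe_add, WithTop.coe_le_coe] at hrhs
    rw [WithTop.coe_le_coe]
    linarith

/-! ### Existence and uniqueness of the coefficients -/

open Classical in
/-- The coefficients, by recursion on the multi-index. -/
def coeffFamily (X a : Fin (2 * d - 1) → K) : MultiIndex d → K :=
  WellFoundedLT.fix fun n (rec : ∀ m < n, K) =>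
    if h : ∃ l m, n = Finsupp.single l m then
      axisCoeff d (X h.choose) (a h.choose) (n h.choose)
    else recRHS X (fun m => if hm : m < n then rec m hm else 0) n / recFactor X n

theorem isCoeffFamily_coeffFamily (hd : 1 ≤ d) (hX : ∀ l, IsSmallRoot d (X l))
    (a : Fin (2 * d - 1) → K) : IsCoeffFamily X a (coeffFamily X a) := by
  have hsingle (l : Fin (2 * d - 1)) (m : ℕ) :
      coeffFamily X a (Finsupp.single l m) = axisCoeff d (X l) (a l) m := by
    have h : ∃ l' m', (Finsupp.single l m : MultiIndex d) = Finsupp.single l' m' := ⟨l, m, rfl⟩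
    rw [coeffFamily, WellFoundedLT.fix_eq, dif_pos h]
    obtain ⟨m', hm'⟩ := h.choose_spec
    rcases Finsupp.single_eq_single_iff .. |>.1 hm' with ⟨h1, -⟩ | ⟨h1, -⟩
    · rw [← h1, Finsupp.single_eq_same]
    · generalize h.choose = l'
      simp [axisCoeff, h1]
  refine ⟨?_, fun l m => hsingle l (m + 1), fun n hn => ?_⟩
  · rw [← Finsupp.single_zero (⟨0, by omega⟩ : Fin (2 * d - 1)), hsingle, axisCoeff]
  · have h : ¬ ∃ l m, n = Finsupp.single l m := by
      push Not
      exact hn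
    rw [RecurrenceAt, coeffFamily, WellFoundedLT.fix_eq, dif_neg h,
      div_mul_cancel₀ _ (recFactor_ne_zero hd hX (two_le_degree hd hn))]
    exact recRHS_congr fun m hm => dif_pos hm

theorem IsCoeffFamily.unique (hd : 1 ≤ d) (hX : ∀ l, IsSmallRoot d (X l))
    {a : Fin (2 * d - 1) → K} {α β : MultiIndex d → K} (hα : IsCoeffFamily X a α)
    (hβ : IsCoeffFamily X a β) : α = β := by
  funext n
  induction n using WellFoundedLT.induction with
  | _ n ih =>
  by_cases hn : ∀ l m, n ≠ Finsupp.single l m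
  · refine mul_right_cancel₀ (recFactor_ne_zero hd hX (two_le_degree hd hn)) ?_
    rw [hα.recurrence n hn, hβ.recurrence n hn]
    exact recRHS_congr ih
  · push Not at hn
    obtain ⟨l, m, rfl⟩ := hn
    rw [hα.single, hβ.single]

/-! ### Convergence -/

theorem IsCoeffFamily.summable (hd : 1 ≤ d) (hX : ∀ l, IsSmallRoot d (X l))
    {a : Fin (2 * d - 1) → K} {α : MultiIndex d → K} (hα : IsCoeffFamily X a α) {A : ℤ}
    (hA : ∀ l, (A : WithTop ℤ) ≤ (a l).orderTop) {j : ℤ} (hj : 0 < A + j + 2) :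
    Summable fun n : MultiIndex d => α n * monom X j n := by
  refine summable_of_orderTop_tendsto fun D => ?_
  have hfin : {n : MultiIndex d | n.degree ≤ (D + 2).toNat}.Finite :=
    Finsupp.finite_of_degree_le _
  refine hfin.subset fun n hn => ?_
  by_contra h
  refine hn ?_
  rw [Set.mem_ofPred_eq, not_le] at h
  change (D : WithTop ℤ) ≤ (α n * monom X j n).orderTop
  rw [HahnSeries.orderTop_mul, orderTop_monom hd hX]
  refine le_trans (WithTop.coe_le_coe.2 (?_ : D ≤ (A * (n.degree : ℤ) +
    2 * ((n.degree : ℤ) - 1)) + j * (n.degree : ℤ))) ?_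
  · have h1 : D + 2 ≤ (n.degree : ℤ) := by omega
    nlinarith
  · rw [WithTop.coe_add]
    exact add_le_add (hα.le_orderTop hd hX hA n) le_rfl

theorem hasSum_formalT {α : MultiIndex d → K} {j : ℤ}
    (h : Summable fun n : MultiIndex d => α n * monom X j n) :
    HasSum (fun n => MvPowerSeries.coeff n (formalT X α j)) (seriesT X α j) := by
  refine hasSum_coeff_mul (hasSum_coeff_C _) ?_
  have h1 := (hasSum_coeff_C (σ := Fin (2 * d - 1)) 1).sub h.hasSum
  simp only [map_one] at h1
  exact h1

theorem le_orderTop_of_pos_add {x : K} {j : ℤ} (h : 0 < x.orderTop + ((j : ℤ) : WithTop ℤ)) :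
    ((1 - j : ℤ) : WithTop ℤ) ≤ x.orderTop := by
  cases hx : x.orderTop with
  | top => exact le_top
  | coe v =>
    rw [hx, ← WithTop.coe_add, ← WithTop.coe_zero, WithTop.coe_lt_coe] at h
    rw [WithTop.coe_le_coe]
    omega

end

end
end EmbeddedTrees

open EmbeddedTrees in
theorem mainTheorem5 (d : ℕ) (hd : 1 ≤ d) :
    {x : K | IsSmallRoot d x}.ncard = 2 * d - 1 ∧
    ∀ X : Fin (2 * d - 1) → K, Function.Injective X → (∀ l, IsSmallRoot d (X l)) →
    ∀ a : Fin (2 * d - 1) → K,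
      (∃! α : MultiIndex d → K, IsCoeffFamily X a α) ∧
      ∀ α : MultiIndex d → K, IsCoeffFamily X a α →
        (∀ l, α (Finsupp.single l 1) = a l) ∧
        (∀ n : MultiIndex d, n ≠ 0 → (∀ l, n ≠ Finsupp.single l 1) → RecurrenceAt X α n) ∧
        (∀ j : ℤ, formalT X α j =
          1 + MvPowerSeries.C (zVar d) * ∏ l ∈ Finset.Icc 1 d,
            (formalT X α (j + 2 * (l : ℤ) - 1) * formalT X α (j - 2 * (l : ℤ) + 1))) ∧
        (∀ j : ℤ, (∀ l, 0 < (a l).orderTop + ((j + 2 : ℤ) : WithTop ℤ)) →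
          Summable fun n : MultiIndex d => α n * monom X j n) ∧
        (∀ j : ℤ, (∀ l, 0 < (a l).orderTop + ((j - (2 * (d : ℤ) - 1) + 2 : ℤ) : WithTop ℤ)) →
          seriesT X α j =
            1 + zVar d * ∏ l ∈ Finset.Icc 1 d,
              (seriesT X α (j + 2 * (l : ℤ) - 1) * seriesT X α (j - 2 * (l : ℤ) + 1))) := by
  refine ⟨ncard_smallRoots hd, fun X _ hX a => ⟨⟨coeffFamily X a,
    isCoeffFamily_coeffFamily hd hX a, fun β hβ =>
      hβ.unique hd hX (isCoeffFamily_coeffFamily hd hX a)⟩, fun α hα => ?_⟩⟩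
  have hformal := formalT_eq (fun l => (hX l).ne_zero) hd hα.zero (hα.recurrenceAt hd hX)
  refine ⟨fun l => ?_, fun n _ _ => hα.recurrenceAt hd hX n, hformal, fun j hj => ?_,
    fun j hj => ?_⟩
  · have h := one_sub_ne_zero_of_orderTop_pos
      (orderTop_pow_pos (hX l).1 (n := 2 * d - 1) (by omega))
    rw [hα.single, axisCoeff]
    simp [h]
  · exact hα.summable hd hX (fun l => le_orderTop_of_pos_add (hj l)) (by omega)
  · have hsum (i : ℤ) (hi : j - (2 * (d : ℤ) - 1) ≤ i) :
        HasSum (fun n => MvPowerSeries.coeff n (formalT X α i)) (seriesT X α i) :=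
      hasSum_formalT (hα.summable hd hX (fun l => le_orderTop_of_pos_add (hj l)) (by omega))
    have hprod := hasSum_coeff_prod (Finset.Icc 1 d) fun l hl =>
      hasSum_coeff_mul
        (hsum (j + 2 * (l : ℤ) - 1) (by rw [Finset.mem_Icc] at hl; omega))
        (hsum (j - 2 * (l : ℤ) + 1) (by rw [Finset.mem_Icc] at hl; omega))
    have hrhs := (hasSum_coeff_C (σ := Fin (2 * d - 1)) 1).add
      (hasSum_coeff_mul (hasSum_coeff_C (zVar d)) hprod)
    simp only [← map_add, map_one] at hrhs
    rw [← hformal j] at hrhs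
    exact (hsum j (by omega)).unique hrhs
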